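/- **Theorem (fundamental theorem of fluxes).** Let $n\ge 1$, $D\ge 0$, and let $f=(f_1,\dots,f_D)$ with each $f_i:\mathbb R^D\to\mathbb R^n$ continuous. Let $u:\mathbb R^n\times[0,\infty)\to\mathbb R^D$ be measurable and a weak solution of $$u_t+\nabla\cdot f(u)=0,$$ that is, for every bounded open $\Omega\subseteq\mathbb R^n$, all $0\le t_1<t_2$ and every $\phi=(\phi_1,\dots,\phi_D)\in C_c^\infty(\Omega\times(t_1,t_2);\mathbb R^D)$, $$\sum_{i=1}^D\int_{t_1}^{t_2}\int_\Omega\Big[u_i\,\partial_t\phi_i+f_i(u)\cdot\nabla_x\phi_i\Big]\,dx\,dt=0,$$ with $u(\cdot,0)=u_0$ a.e., where $u_0\in L^1(\mathbb R^n;\mathbb R^D)\cap L^\infty(\mathbb R^n;\mathbb R^D)$. Assume that - $u$ is (essentially) bounded on every compact subset of $\mathbb R^n\times[0,\infty)$; - for every bounded open $\Omega\subseteq\mathbb R^n$, $u(\cdot,t)$ is integrable on $\Omega$ for every $t\ge 0$, and the mass $m(t)=\int_\Omega u(x,t)\,dx$ is continuous in $t\in[0,\infty)$. Let $\Omega\subseteq\mathbb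 R^n$ be a bounded open set with smooth boundary (locally on one side of it; $\Omega$ need not be connected), and let $0\le t_1<t_2$. Then the flux $$h_i(t_1,t_2)=\int_{t_1}^{t_2}\int_{\partial\Omega}f_i(u(x,t))\cdot\nu\,dS\,dt,\qquad i=1,\dots,D,$$ is well defined in the following sense. Let $d(x)=\operatorname{dist}(x,\Omega)-\operatorname{dist}(x,\Omega^c)$ be the signed distance, $\Omega_y=\{x: d(x)<y\}$ (so $\Omega_0=\Omega$), $\Gamma_y=\partial\Omega_y$, $\nu$ the outward unit normal to $\Omega_y$, and $dS_y$ the surface measure on $\Gamma_y$. There is $\delta>0$ and a Lipschitz function $H:(-\delta,\delta)\to\mathbb R^D$ such that for almost every $y\in(-\delta,\delta)$ and every $i$ the function $f_i(u(x,t))\cdot\nu(x)$ is integrable on $\Gamma_y\times[t_1,t_2]$ and $$H_i(y)=\int_{t_1}^{t_2}\int_{\Gamma_y}f_i(u(x,t))\cdot\nu\,dS_y\,dt ;$$ the flux through $\partial\Omega$ is $h(t_1,t_2):=H(0)$, and this value does not depend on the choice of $\delta$ and $H$. Moreover the balance law holds: $$\int_\Omega u_i(x,t_2)\,dx-\int_\Omega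 u_i(x,t_1)\,dx=-h_i(t_1,t_2),\qquad i=1,\dots,D.$$ -/

import Mathlib

open MeasureTheory Set Filter Topology
open scoped ContDiff Gradient NNReal

noncomputable section

/-- `ρ` is a smooth local defining function of `Ω` at `x`: near `x` the function `ρ` is smooth, has
a nonvanishing gradient, and `Ω` is the set where `ρ` is negative. -/
def IsLocalDefiningFunction {n : ℕ} (Ω : Set (EuclideanSpace ℝ (Fin n)))
    (x : EuclideanSpace ℝ (Fin n)) (ρ : EuclideanSpace ℝ (Fin n) → ℝ) : Prop :=
  ∃ U : Set (EuclideanSpace ℝ (Fin n)), IsOpen U ∧ x ∈ U ∧ ContDiffOn ℝ ∞ ρ U ∧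
    (∀ z ∈ U, ∇ ρ z ≠ 0) ∧ ∀ z ∈ U, z ∈ Ω ↔ ρ z < 0

/-- Bounded open set with smooth boundary, lying locally on one side of it.
Connectedness is not required. -/
structure IsSmoothBoundedDomain {n : ℕ} (Ω : Set (EuclideanSpace ℝ (Fin n))) : Prop where
  isOpen : IsOpen Ω
  isBounded : Bornology.IsBounded Ω
  smooth_boundary : ∀ x ∈ frontier Ω, ∃ ρ, IsLocalDefiningFunction Ω x ρ

/-- `ν` is the outward unit normal to `∂Ω` at `x`: the normalised gradient of a local defining
function. -/
def IsOutwardUnitNormal {n : ℕ} (Ω : Set (EuclideanSpace ℝ (Fin n)))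
    (x ν : EuclideanSpace ℝ (Fin n)) : Prop :=
  ∃ ρ, IsLocalDefiningFunction Ω x ρ ∧ ν = ‖∇ ρ x‖⁻¹ • ∇ ρ x

open Classical in
/-- The outward unit normal to `∂Ω` at `x` (zero where there is none). -/
def outwardUnitNormal {n : ℕ} (Ω : Set (EuclideanSpace ℝ (Fin n)))
    (x : EuclideanSpace ℝ (Fin n)) : EuclideanSpace ℝ (Fin n) :=
  if h : ∃ ν, IsOutwardUnitNormal Ω x ν then h.choose else 0

/-- Signed distance to the boundary of `Ω`: negative inside, positive outside. -/
def signedInfDist {n : ℕ} (Ω : Set (EuclideanSpace ℝ (Fin n)))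
    (x : EuclideanSpace ℝ (Fin n)) : ℝ :=
  Metric.infDist x Ω - Metric.infDist x Ωᶜ

/-- The expanding family `Ω_y` of domains parallel to `Ω = Ω_0`. For a smooth bounded domain and
small `|y|`, the boundaries `Γ_y = ∂Ω_y` foliate a tubular neighbourhood of `∂Ω`, and `y` is the
coordinate along the unit normal. -/
def parallelDomain {n : ℕ} (Ω : Set (EuclideanSpace ℝ (Fin n))) (y : ℝ) :
    Set (EuclideanSpace ℝ (Fin n)) :=
  {x | signedInfDist Ω x < y}

/-- The normal component `f_i(u(x,t)) · ν(x)` of the `i`-th flux, with `ν` the outward unit normal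
to `∂Ω`. -/
def normalFluxDensity {n D : ℕ}
    (f : EuclideanSpace ℝ (Fin D) → Fin D → EuclideanSpace ℝ (Fin n))
    (u : EuclideanSpace ℝ (Fin n) → ℝ → EuclideanSpace ℝ (Fin D))
    (Ω : Set (EuclideanSpace ℝ (Fin n))) (i : Fin D) (x : EuclideanSpace ℝ (Fin n)) (t : ℝ) : ℝ :=
  inner ℝ (f (u x t) i) (outwardUnitNormal Ω x)

/-- Surface measure on `∂Ω`: the normalised `(n-1)`-dimensional Hausdorff measure. -/
def surfaceMeasure {n : ℕ} (Ω : Set (EuclideanSpace ℝ (Fin n))) :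
    Measure (EuclideanSpace ℝ (Fin n)) :=
  (Measure.euclideanHausdorffMeasure (n - 1)).restrict (frontier Ω)

/-- The time-integrated flux `h_i = ∫_{t₁}^{t₂} ∫_{∂Ω} f_i(u) · ν dS dt`, as an iterated integral
of the given pointwise values of `u` on `∂Ω`. -/
def fluxIntegral {n D : ℕ}
    (f : EuclideanSpace ℝ (Fin D) → Fin D → EuclideanSpace ℝ (Fin n))
    (u : EuclideanSpace ℝ (Fin n) → ℝ → EuclideanSpace ℝ (Fin D))
    (t₁ t₂ : ℝ) (Ω : Set (EuclideanSpace ℝ (Fin n))) (i : Fin D) : ℝ :=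
  ∫ t in t₁..t₂, ∫ x, normalFluxDensity f u Ω i x t ∂(surfaceMeasure Ω)

/-- `h` is the flux through `∂Ω` over `[t₁,t₂]`, in the sense of traces: for almost every `y` in a
neighbourhood `(-δ, δ)` of `0` the flux through `∂Ω_y` exists as an absolutely convergent integral,
these fluxes are given by a Lipschitz function `H` of `y`, and `h = H 0`. (As `u` is only
determined almost everywhere, its values on the null set `∂Ω × [t₁,t₂]` carry no information.) -/
def IsBoundaryFlux {n D : ℕ}
    (f : EuclideanSpace ℝ (Fin D) → Fin D → EuclideanSpace ℝ (Fin n))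
    (u : EuclideanSpace ℝ (Fin n) → ℝ → EuclideanSpace ℝ (Fin D))
    (Ω : Set (EuclideanSpace ℝ (Fin n))) (t₁ t₂ : ℝ) (h : Fin D → ℝ) : Prop :=
  ∃ δ : ℝ, 0 < δ ∧ ∃ H : ℝ → Fin D → ℝ,
    (∃ K : ℝ≥0, LipschitzOnWith K H (Ioo (-δ) δ)) ∧
    (∀ᵐ y ∂(volume.restrict (Ioo (-δ) δ)), ∀ i : Fin D,
      Integrable
        (fun z : EuclideanSpace ℝ (Fin n) × ℝ =>
          normalFluxDensity f u (parallelDomain Ω y) i z.1 z.2)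
        ((surfaceMeasure (parallelDomain Ω y)).prod (volume.restrict (Icc t₁ t₂))) ∧
      H y i = fluxIntegral f u t₁ t₂ (parallelDomain Ω y) i) ∧
    H 0 = h

/-- `u` is a weak solution of `u_t + ∇ · f(u) = 0` in `ℝⁿ × (0, ∞)`. -/
def IsWeakSolution {n D : ℕ}
    (f : EuclideanSpace ℝ (Fin D) → Fin D → EuclideanSpace ℝ (Fin n))
    (u : EuclideanSpace ℝ (Fin n) → ℝ → EuclideanSpace ℝ (Fin D)) : Prop :=
  ∀ (Ω : Set (EuclideanSpace ℝ (Fin n))) (t₁ t₂ : ℝ), IsOpen Ω → Bornology.IsBounded Ω →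
    0 ≤ t₁ → t₁ < t₂ →
    ∀ φ : EuclideanSpace ℝ (Fin n) × ℝ → EuclideanSpace ℝ (Fin D),
      ContDiff ℝ ∞ φ → HasCompactSupport φ → tsupport φ ⊆ Ω ×ˢ Ioo t₁ t₂ →
      ∑ i : Fin D, ∫ t in t₁..t₂, ∫ x in Ω,
        (u x t i * deriv (fun s => φ (x, s) i) t
          + inner ℝ (f (u x t) i) (∇ (fun z => φ (z, t) i) x)) = 0

/-- `u` is (essentially) bounded on every compact subset of `ℝⁿ × [0, ∞)`. -/
def IsLocallyBounded {n D : ℕ}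
    (u : EuclideanSpace ℝ (Fin n) → ℝ → EuclideanSpace ℝ (Fin D)) : Prop :=
  ∀ K : Set (EuclideanSpace ℝ (Fin n) × ℝ), IsCompact K → K ⊆ univ ×ˢ Ici 0 →
    ∃ C : ℝ, ∀ᵐ z ∂(volume.restrict K), ‖u z.1 z.2‖ ≤ C

/-- For every bounded open `Ω`, the mass `∫_Ω u(x,t) dx` is well defined for every `t ≥ 0` and
continuous in `t ∈ [0, ∞)`. -/
def HasContinuousMass {n D : ℕ}
    (u : EuclideanSpace ℝ (Fin n) → ℝ → EuclideanSpace ℝ (Fin D)) : Prop :=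
  ∀ Ω : Set (EuclideanSpace ℝ (Fin n)), IsOpen Ω → Bornology.IsBounded Ω →
    (∀ t : ℝ, 0 ≤ t → IntegrableOn (fun x => u x t) Ω) ∧
    ContinuousOn (fun t : ℝ => ∫ x in Ω, u x t) (Ici 0)

end

/-! The flux through a surface is read off from the mass that the surface encloses. Let m_y(t) be
the mass of u in the parallel domain Ω_y and put H(y) = -(m_y(t₂) - m_y(t₁)). The balance law is
then the definition of H(0). Two facts remain: H is Lipschitz, and H(y) is the flux through Γ_y for
almost every y.

Lipschitz bound. Between two parallel domains the mass changes by at most a bound for |u| times the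
volume of the shell, and that volume is linear in the width because the areas of the leaves are
bounded (`volume_parallelDomain_diff_le`). The essential bound gives this only for almost every t;
continuity of the mass extends it to t₁ and t₂ (`abs_mass_le`).

Identification. Test the equation against χ(t) ψ(d(x)) with ψ' = -g. As ∇d is the normal of every
leaf, the coarea formula turns the flux term into ∫ g(y) G(y) dy, with G(y) the flux through Γ_y;
the layer-cake formula turns the mass term into ∫ g(y) m_y(t) dy. One du Bois-Reymond argument in t
removes χ (`sub_eq_neg_integral_of_weak_deriv`), and another in y removes g
(`ae_neg_mass_sub_eq_flux`).

Geometry. Near ∂Ω the signed distance is smooth with unit gradient, by the inverse function theorem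
in normal coordinates (`IsLocalDefiningFunction.exists_nhds_signedInfDist`). For such a function the
coarea formula (`coarea_unit_gradient`) reduces to Fubini for hyperplanes, since it is straightened
locally by maps with bi-Lipschitz constant as close to 1 as desired.

Uniqueness of H(0): continuous functions that agree almost everywhere near 0 agree at 0. -/

/-! ### Coarea formula for functions with unit gradient -/

section Coarea

open scoped ENNReal
open Module

/-- A function with unit gradient is, near each point, almost isometrically straightened. -/
theorem exists_flattening {E : Type*} [NormedAddCommGroup E] [InnerProductSpace ℝ E]
    {d : E → ℝ} {x₀ N : E} (hN : ‖N‖ = 1)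
    (hd : HasStrictFDerivAt d (innerSL ℝ N) x₀) {c : ℝ≥0} (hc : 1 < c) :
    ∃ V : Set E, IsOpen V ∧ x₀ ∈ V ∧ ∃ Θ : E → E, LipschitzOnWith c Θ V ∧
      (∀ x ∈ V, ∀ y ∈ V, edist x y ≤ c * edist (Θ x) (Θ y)) ∧ ∀ x, inner ℝ N (Θ x) = d x := by
  -- Only the N-component of x is changed, to the value d x. The correction has derivative zero at
  -- x₀, so Θ is strictly tangent to the identity there.
  set Θ : E → E := fun x => x + (d x - inner ℝ N x) • N with hΘ
  have hstrict : HasStrictFDerivAt Θ (ContinuousLinearMap.id ℝ E) x₀ := by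
    have h1 : HasStrictFDerivAt (fun x => d x - inner ℝ N x) (innerSL ℝ N - innerSL ℝ N) x₀ :=
      hd.sub (innerSL ℝ N).hasStrictFDerivAt
    have h2 := (hasStrictFDerivAt_id x₀).add (h1.smul_const N)
    refine h2.congr_fderiv ?_
    ext v; simp
  have hc0 : (0 : ℝ) < c := by exact_mod_cast (zero_lt_one.trans hc)
  have hc1 : (1 : ℝ) < c := by exact_mod_cast hc
  -- This ε serves both estimates: the lower one needs 1 - ε = 1/c, the upper one 1 + ε = 2 - 1/c ≤
  -- c, which is (c - 1)² ≥ 0.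
  have hε : (0 : ℝ) < 1 - 1 / c := by
    rw [sub_pos, div_lt_one hc0]; exact hc1
  have hev := hstrict.isLittleO.def hε
  rw [nhds_prod_eq] at hev
  obtain ⟨W, hW, hWW⟩ := Filter.mem_prod_self_iff.1 hev
  have hWΘ : ∀ x ∈ W, ∀ y ∈ W, _ := fun x hx y hy => hWW (mk_mem_prod hx hy)
  obtain ⟨V, hVW, hVo, hxV⟩ := mem_nhds_iff.1 hW
  refine ⟨V, hVo, hxV, Θ, ?_, ?_, ?_⟩
  · refine LipschitzOnWith.of_dist_le_mul fun x hx y hy => ?_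
    have h := hWΘ x (hVW hx) y (hVW hy)
    simp only [mem_ofPred_eq, ContinuousLinearMap.coe_id', id] at h
    rw [dist_eq_norm, dist_eq_norm]
    calc ‖Θ x - Θ y‖ = ‖(Θ x - Θ y - (x - y)) + (x - y)‖ := by simp
      _ ≤ (1 - 1 / c) * ‖x - y‖ + ‖x - y‖ := (norm_add_le _ _).trans (by gcongr)
      _ = (2 - 1 / c) * ‖x - y‖ := by ring
      _ ≤ c * ‖x - y‖ := by
        gcongr
        rw [sub_le_iff_le_add, ← sub_nonneg]
        have : (c : ℝ) + 1 / c - 2 = (c - 1) ^ 2 / c := by field_simp; ring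
        rw [this]; positivity
  · intro x hx y hy
    have h := hWΘ x (hVW hx) y (hVW hy)
    simp only [mem_ofPred_eq, ContinuousLinearMap.coe_id', id] at h
    rw [edist_nndist, edist_nndist]
    norm_cast
    rw [← NNReal.coe_le_coe, NNReal.coe_mul, coe_nndist, coe_nndist, dist_eq_norm, dist_eq_norm]
    have h1 : ‖x - y‖ ≤ ‖Θ x - Θ y - (x - y)‖ + ‖Θ x - Θ y‖ := by
      calc ‖x - y‖ = ‖(Θ x - Θ y) - (Θ x - Θ y - (x - y))‖ := by simp
        _ ≤ _ := (norm_sub_le _ _).trans (by rw [add_comm])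
    have h2 : 1 / (c : ℝ) * ‖x - y‖ ≤ ‖Θ x - Θ y‖ := by linarith
    rw [one_div, inv_mul_le_iff₀ hc0] at h2
    exact h2
  · intro x
    simp [hΘ, inner_add_right, inner_smul_right, hN]

variable {E : Type*} [NormedAddCommGroup E] [InnerProductSpace ℝ E] [FiniteDimensional ℝ E]
  [MeasurableSpace E] [BorelSpace E]

theorem LipschitzOnWith.euclideanHausdorffMeasure_image_le {X Y : Type*} [EMetricSpace X]
    [MeasurableSpace X] [BorelSpace X] [EMetricSpace Y] [MeasurableSpace Y] [BorelSpace Y]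
    {c : ℝ≥0} {g : X → Y} {A : Set X} (h : LipschitzOnWith c g A) (k : ℕ) :
    μHE[k] (g '' A) ≤ (c : ℝ≥0∞) ^ k * μHE[k] A := by
  simp_rw [Measure.euclideanHausdorffMeasure_def, Measure.smul_apply]
  have := h.hausdorffMeasure_image_le (d := k) (by positivity)
  rw [ENNReal.rpow_natCast] at this
  rw [mul_smul_comm]
  gcongr

theorem euclideanHausdorffMeasure_le_image {X Y : Type*} [EMetricSpace X]
    [MeasurableSpace X] [BorelSpace X] [EMetricSpace Y] [MeasurableSpace Y] [BorelSpace Y]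
    {c : ℝ≥0} {g : X → Y} {A : Set X} (h : ∀ x ∈ A, ∀ y ∈ A, edist x y ≤ c * edist (g x) (g y))
    (k : ℕ) : μHE[k] A ≤ (c : ℝ≥0∞) ^ k * μHE[k] (g '' A) := by
  rcases A.eq_empty_or_nonempty with rfl | ⟨a, -⟩
  · simp
  have : Nonempty X := ⟨a⟩
  have hinj : InjOn g A := fun x hx y hy hxy => by
    have := h x hx y hy
    rw [hxy, edist_self, mul_zero] at this
    exact edist_le_zero.1 this
  have hL : LipschitzOnWith c (Function.invFunOn g A) (g '' A) := by
    rintro _ ⟨x, hx, rfl⟩ _ ⟨y, hy, rfl⟩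
    rw [hinj.leftInvOn_invFunOn hx, hinj.leftInvOn_invFunOn hy]
    exact h x hx y hy
  have := hL.euclideanHausdorffMeasure_image_le k
  rwa [hinj.leftInvOn_invFunOn.image_image] at this

/-- Slices by parallel hyperplanes have measurable Hausdorff measure. -/
theorem measurable_euclideanHausdorffMeasure_inter_hyperplane {N : E} (hN : ‖N‖ = 1)
    {B : Set E} (hB : MeasurableSet B) :
    Measurable fun y : ℝ => μHE[finrank ℝ E - 1] (B ∩ {x | inner ℝ N x = y}) := by
  have hN0 : N ≠ 0 := by rintro rfl; simp at hN
  have hrank : finrank ℝ (ℝ ∙ N)ᗮ = finrank ℝ E - 1 := by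
    rw [← (ℝ ∙ N).finrank_add_finrank_orthogonal, finrank_span_singleton hN0,
      Nat.add_sub_cancel_left]
  -- Translation by y • N maps the orthogonal complement of N isometrically onto the hyperplane, so
  -- the slices become sections of one measurable set in a product, and Tonelli applies.
  have key : ∀ y : ℝ, μHE[finrank ℝ E - 1] (B ∩ {x | inner ℝ N x = y}) =
      (volume : Measure (ℝ ∙ N)ᗮ) (Prod.mk y ⁻¹' {p : ℝ × (ℝ ∙ N)ᗮ | (p.2 : E) + p.1 • N ∈ B}) := by
    intro y
    have hiso : Isometry fun k : (ℝ ∙ N)ᗮ => (k : E) + y • N :=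
      (isometry_add_right (y • N)).comp isometry_subtype_coe
    rw [← InnerProductSpace.euclideanHausdorffMeasure_eq_volume, hrank,
      ← hiso.euclideanHausdorffMeasure_image]
    congr 1
    ext x
    constructor
    · rintro ⟨hx, hxy⟩
      refine ⟨⟨x - y • N, ?_⟩, ?_, ?_⟩
      · rw [Submodule.mem_orthogonal_singleton_iff_inner_right, inner_sub_right, inner_smul_right,
          hxy, real_inner_self_eq_norm_sq, hN]
        simp
      · simpa using hx
      · simp
    · rintro ⟨k, hk, rfl⟩
      refine ⟨hk, ?_⟩
      have := (Submodule.mem_orthogonal_singleton_iff_inner_right (𝕜 := ℝ)).1 k.2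
      simp [inner_add_right, inner_smul_right, this, hN]
  simp_rw [key]
  refine measurable_measure_prodMk_left ?_
  have : Measurable fun p : ℝ × (ℝ ∙ N)ᗮ => (p.2 : E) + p.1 • N := by fun_prop
  exact this hB

/-- The flat case of the coarea formula, to which the curved case is reduced. -/
theorem lintegral_euclideanHausdorffMeasure_inter_hyperplane {N : E} (hN : ‖N‖ = 1)
    {B : Set E} (hB : MeasurableSet B) :
    ∫⁻ y : ℝ, μHE[finrank ℝ E - 1] (B ∩ {x | inner ℝ N x = y}) = volume B := by
  have hN0 : N ≠ 0 := by rintro rfl; simp at hN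
  have := EuclideanGeometry.euclideanHausdorffMeasure_eq_lintegral (0 : E) hN0 hB
  rw [InnerProductSpace.euclideanHausdorffMeasure_eq_volume, ← ofReal_norm, hN, ENNReal.ofReal_one,
    one_mul] at this
  rw [this]
  congr with y
  congr 2
  ext x
  simp [AffineSubspace.mem_mk', Submodule.mem_orthogonal_singleton_iff_inner_right, inner_sub_right,
    inner_smul_right, hN, sub_eq_zero]

/-- Up to a factor close to `1`, the slices of a small set by the level sets of a function with unit
gradient have the measures of slices by parallel hyperplanes. -/
theorem exists_local_slice_approximation {d : E → ℝ} {x₀ N : E} (hN : ‖N‖ = 1)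
    (hd : HasStrictFDerivAt d (innerSL ℝ N) x₀) {c : ℝ≥0} (hc : 1 < c) :
    ∃ V : Set E, IsOpen V ∧ x₀ ∈ V ∧ ∀ A ⊆ V, MeasurableSet A → ∃ m : ℝ → ℝ≥0∞, Measurable m ∧
      (∀ y, m y ≤ (c : ℝ≥0∞) ^ (finrank ℝ E - 1) * μHE[finrank ℝ E - 1] (A ∩ {x | d x = y})) ∧
      (∀ y, μHE[finrank ℝ E - 1] (A ∩ {x | d x = y}) ≤ (c : ℝ≥0∞) ^ (finrank ℝ E - 1) * m y) ∧
      ∫⁻ y, m y ≤ (c : ℝ≥0∞) ^ finrank ℝ E * volume A ∧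
      volume A ≤ (c : ℝ≥0∞) ^ finrank ℝ E * ∫⁻ y, m y := by
  obtain ⟨V, hVo, hxV, Θ, hL, hA, hΘ⟩ := exists_flattening hN hd hc
  refine ⟨V, hVo, hxV, fun A hAV hAm => ?_⟩
  have hinj : InjOn Θ V := fun x hx y hy hxy => by
    have := hA x hx y hy
    rw [hxy, edist_self, mul_zero] at this
    exact edist_le_zero.1 this
  have hB : MeasurableSet (Θ '' A) :=
    hAm.image_of_continuousOn_injOn (hL.continuousOn.mono hAV) (hinj.mono hAV)
  have himg : ∀ y, Θ '' A ∩ {x | inner ℝ N x = y} = Θ '' (A ∩ {x | d x = y}) := by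
    intro y
    ext z
    constructor
    · rintro ⟨⟨x, hx, rfl⟩, hxy⟩
      exact ⟨x, ⟨hx, by rw [mem_ofPred_eq, hΘ] at hxy; exact hxy⟩, rfl⟩
    · rintro ⟨x, ⟨hx, hxy⟩, rfl⟩
      exact ⟨⟨x, hx, rfl⟩, by rw [mem_ofPred_eq, hΘ]; exact hxy⟩
  refine ⟨_, measurable_euclideanHausdorffMeasure_inter_hyperplane hN hB, ?_, ?_, ?_, ?_⟩
  · intro y
    rw [himg]
    exact (hL.mono (inter_subset_left.trans hAV)).euclideanHausdorffMeasure_image_le _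
  · intro y
    rw [himg]
    exact euclideanHausdorffMeasure_le_image
      (fun x hx z hz => hA x (hAV hx.1) z (hAV hz.1)) _
  · rw [lintegral_euclideanHausdorffMeasure_inter_hyperplane hN hB,
      ← InnerProductSpace.euclideanHausdorffMeasure_eq_volume]
    exact (hL.mono hAV).euclideanHausdorffMeasure_image_le _
  · rw [lintegral_euclideanHausdorffMeasure_inter_hyperplane hN hB,
      ← InnerProductSpace.euclideanHausdorffMeasure_eq_volume]
    exact euclideanHausdorffMeasure_le_image (fun x hx z hz => hA x (hAV hx) z (hAV hz)) _

/-- By the Lindelöf property countably many flattening neighbourhoods suffice; made disjoint, they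
cut A into pieces. All pieces share the same c, so the local estimates add up without loss. -/
theorem exists_slice_approximation {d : E → ℝ} (hdc : Continuous d) {U : Set E}
    (hd : ∀ x ∈ U, ∃ N : E, ‖N‖ = 1 ∧ HasStrictFDerivAt d (innerSL ℝ N) x) {c : ℝ≥0} (hc : 1 < c)
    {A : Set E} (hAU : A ⊆ U) (hA : MeasurableSet A) :
    ∃ m : ℝ → ℝ≥0∞, Measurable m ∧
      (∀ y, m y ≤ (c : ℝ≥0∞) ^ (finrank ℝ E - 1) * μHE[finrank ℝ E - 1] (A ∩ {x | d x = y})) ∧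
      (∀ y, μHE[finrank ℝ E - 1] (A ∩ {x | d x = y}) ≤ (c : ℝ≥0∞) ^ (finrank ℝ E - 1) * m y) ∧
      ∫⁻ y, m y ≤ (c : ℝ≥0∞) ^ finrank ℝ E * volume A ∧
      volume A ≤ (c : ℝ≥0∞) ^ finrank ℝ E * ∫⁻ y, m y := by
  have hloc : ∀ x : E, ∃ V : Set E, IsOpen V ∧ (x ∈ U → x ∈ V) ∧
      ∀ A ⊆ V, MeasurableSet A → ∃ m : ℝ → ℝ≥0∞, Measurable m ∧
      (∀ y, m y ≤ (c : ℝ≥0∞) ^ (finrank ℝ E - 1) * μHE[finrank ℝ E - 1] (A ∩ {x | d x = y})) ∧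
      (∀ y, μHE[finrank ℝ E - 1] (A ∩ {x | d x = y}) ≤ (c : ℝ≥0∞) ^ (finrank ℝ E - 1) * m y) ∧
      ∫⁻ y, m y ≤ (c : ℝ≥0∞) ^ finrank ℝ E * volume A ∧
      volume A ≤ (c : ℝ≥0∞) ^ finrank ℝ E * ∫⁻ y, m y := by
    intro x
    by_cases hx : x ∈ U
    · obtain ⟨N, hN, hdN⟩ := hd x hx
      obtain ⟨V, hVo, hxV, hV⟩ := exists_local_slice_approximation hN hdN hc
      exact ⟨V, hVo, fun _ => hxV, hV⟩
    · refine ⟨∅, isOpen_empty, fun h => absurd h hx, fun A hA _ => ⟨0, measurable_const, ?_⟩⟩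
      simp [subset_empty_iff.1 hA]
  choose V hVo hxV hV using hloc
  obtain ⟨T, hT, hTV⟩ := TopologicalSpace.isOpen_iUnion_countable V hVo
  have hAT : A ⊆ ⋃ x ∈ T, V x := fun x hx => hTV ▸ mem_iUnion.2 ⟨x, hxV x (hAU hx)⟩
  rcases T.eq_empty_or_nonempty with rfl | hTne
  · have : A = ∅ := by simpa [subset_empty_iff] using hAT
    refine ⟨0, measurable_const, ?_⟩
    simp [this]
  obtain ⟨x, rfl⟩ := hT.exists_eq_range hTne
  rw [biUnion_range, ← iUnion_disjointed] at hAT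
  set B : ℕ → Set E := fun j => A ∩ disjointed (fun j => V (x j)) j
  have hBm : ∀ j, MeasurableSet (B j) := fun j =>
    hA.inter (MeasurableSet.disjointed (fun j => (hVo _).measurableSet) j)
  have hBd : Pairwise (Function.onFun Disjoint B) := fun i j hij =>
    ((disjoint_disjointed _) hij).mono inter_subset_right inter_subset_right
  have hBU : A = ⋃ j, B j := by
    rw [← inter_iUnion, inter_eq_left.2 hAT]
  choose m hm hm₁ hm₂ hm₃ hm₄ using fun j =>
    hV (x j) (B j) (inter_subset_right.trans (disjointed_subset _ j)) (hBm j)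
  have hslice : ∀ y, μHE[finrank ℝ E - 1] (A ∩ {x | d x = y}) =
      ∑' j, μHE[finrank ℝ E - 1] (B j ∩ {x | d x = y}) := by
    intro y
    rw [hBU, iUnion_inter, measure_iUnion]
    · exact fun i j hij => (hBd hij).mono inter_subset_left inter_subset_left
    · exact fun j => (hBm j).inter (isClosed_eq hdc continuous_const).measurableSet
  have hvol : volume A = ∑' j, volume (B j) := by
    conv_lhs => rw [hBU]
    exact measure_iUnion hBd hBm
  have hint : ∫⁻ y, ∑' j, m j y = ∑' j, ∫⁻ y, m j y :=
    lintegral_tsum fun j => (hm j).aemeasurable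
  refine ⟨fun y => ∑' j, m j y, Measurable.tsum hm, fun y => ?_, fun y => ?_, ?_, ?_⟩
  · rw [hslice, ← ENNReal.tsum_mul_left]
    exact ENNReal.tsum_le_tsum fun j => hm₁ j y
  · rw [hslice, ← ENNReal.tsum_mul_left]
    exact ENNReal.tsum_le_tsum fun j => hm₂ j y
  · rw [hint, hvol, ← ENNReal.tsum_mul_left]
    exact ENNReal.tsum_le_tsum hm₃
  · rw [hint, hvol, ← ENNReal.tsum_mul_left]
    exact ENNReal.tsum_le_tsum hm₄

/-- Coarea formula for a function with unit gradient: the level slices of a measurable set have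
measurable area, and the areas integrate to the volume. -/
theorem coarea_unit_gradient {d : E → ℝ} (hdc : Continuous d) {U : Set E}
    (hd : ∀ x ∈ U, ∃ N : E, ‖N‖ = 1 ∧ HasStrictFDerivAt d (innerSL ℝ N) x)
    {A : Set E} (hAU : A ⊆ U) (hA : MeasurableSet A) :
    Measurable (fun y : ℝ => μHE[finrank ℝ E - 1] (A ∩ {x | d x = y})) ∧
      ∫⁻ y : ℝ, μHE[finrank ℝ E - 1] (A ∩ {x | d x = y}) = volume A := by
  set h : ℝ → ℝ≥0∞ := fun y => μHE[finrank ℝ E - 1] (A ∩ {x | d x = y})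
  set k := finrank ℝ E - 1
  set n := finrank ℝ E
  set c : ℕ → ℝ≥0 := fun j => 1 + 1 / ((j : ℝ≥0) + 1)
  have hc : ∀ j, 1 < c j := fun j => by simp only [c]; simp
  have hc0 : ∀ j l, ((c j : ℝ≥0∞)) ^ l ≠ 0 := fun j l => by
    have := zero_lt_one.trans (hc j)
    simp [this.ne']
  have hctop : ∀ j l, ((c j : ℝ≥0∞)) ^ l ≠ ⊤ := fun j l => by simp
  have hlim : Tendsto c atTop (𝓝 1) := by
    have : Tendsto (fun j : ℕ => 1 / ((j : ℝ≥0) + 1)) atTop (𝓝 0) :=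
      tendsto_one_div_add_atTop_nhds_zero_nat
    simpa only [add_zero] using this.const_add 1
  have hpow : ∀ (l : ℕ) (a : ℝ≥0∞), Tendsto (fun j => (c j : ℝ≥0∞) ^ l * a) atTop (𝓝 a) := by
    intro l a
    have h1 : Tendsto (fun j => (c j : ℝ≥0∞) ^ l) atTop (𝓝 1) := by
      have := ENNReal.tendsto_coe.2 (hlim.pow l)
      simpa only [one_pow, ENNReal.coe_pow, ENNReal.coe_one] using this
    simpa using ENNReal.Tendsto.mul_const h1 (Or.inl one_ne_zero)
  choose m hm hm₁ hm₂ hm₃ hm₄ using fun j => exists_slice_approximation hdc hd (hc j) hAU hA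
  -- The two-sided comparison squeezes m j y to h y as c j → 1. Measurability of h, not evident from
  -- the Hausdorff measures, is inherited from the m j.
  have hpt : ∀ y, Tendsto (fun j => m j y) atTop (𝓝 (h y)) := by
    intro y
    have h2 : Tendsto (fun j => ((c j : ℝ≥0∞) ^ k)⁻¹ * h y) atTop (𝓝 (h y)) := by
      have h1 : Tendsto (fun j => ((c j : ℝ≥0∞) ^ k)⁻¹) atTop (𝓝 1) := by
        have h0 : Tendsto (fun j => (c j : ℝ≥0∞) ^ k) atTop (𝓝 1) := by simpa using hpow k 1
        simpa using h0.inv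
      simpa using ENNReal.Tendsto.mul_const h1 (Or.inl one_ne_zero)
    refine tendsto_of_tendsto_of_tendsto_of_le_of_le h2 (hpow k (h y)) (fun j => ?_)
      (fun j => hm₁ j y)
    exact (ENNReal.inv_mul_le_iff (hc0 j k) (hctop j k)).2 (hm₂ j y)
  have hmeas : Measurable h := measurable_of_tendsto_metrizable hm (tendsto_pi_nhds.2 hpt)
  refine ⟨hmeas, le_antisymm ?_ ?_⟩
  · refine ge_of_tendsto' (hpow (k + n) (volume A)) fun j => ?_
    calc ∫⁻ y, h y ≤ ∫⁻ y, (c j : ℝ≥0∞) ^ k * m j y := lintegral_mono (hm₂ j)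
      _ = (c j : ℝ≥0∞) ^ k * ∫⁻ y, m j y := lintegral_const_mul _ (hm j)
      _ ≤ (c j : ℝ≥0∞) ^ k * ((c j : ℝ≥0∞) ^ n * volume A) := by gcongr; exact hm₃ j
      _ = _ := by rw [pow_add, mul_assoc]
  · refine ge_of_tendsto' (hpow (n + k) (∫⁻ y, h y)) fun j => ?_
    calc volume A ≤ (c j : ℝ≥0∞) ^ n * ∫⁻ y, m j y := hm₄ j
      _ ≤ (c j : ℝ≥0∞) ^ n * ∫⁻ y, (c j : ℝ≥0∞) ^ k * h y := by gcongr; exact hm₁ j _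
      _ = _ := by rw [lintegral_const_mul _ hmeas, pow_add, mul_assoc]

/-- The level sets of a function with unit gradient have locally bounded area. -/
theorem exists_nhds_slice_le {d : E → ℝ} {x₀ N : E} (hN : ‖N‖ = 1)
    (hd : HasStrictFDerivAt d (innerSL ℝ N) x₀) :
    ∃ V : Set E, IsOpen V ∧ x₀ ∈ V ∧ ∃ C : ℝ≥0, ∀ y,
      μHE[finrank ℝ E - 1] (V ∩ {x | d x = y}) ≤ C := by
  obtain ⟨V, hVo, hxV, Θ, hL, hA, hΘ⟩ := exists_flattening hN hd one_lt_two
  have hN0 : N ≠ 0 := by rintro rfl; simp at hN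
  have hrank : finrank ℝ (ℝ ∙ N)ᗮ = finrank ℝ E - 1 := by
    rw [← (ℝ ∙ N).finrank_add_finrank_orthogonal, finrank_span_singleton hN0,
      Nat.add_sub_cancel_left]
  set g : E → (ℝ ∙ N)ᗮ := fun x => (ℝ ∙ N)ᗮ.orthogonalProjectionOnto (Θ x) with hg
  have hbdd : Bornology.IsBounded (g '' (V ∩ Metric.ball x₀ 1)) := by
    have h1 : Bornology.IsBounded (Θ '' (V ∩ Metric.ball x₀ 1)) := by
      refine (Metric.isBounded_closedBall (x := Θ x₀) (r := 2)).subset ?_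
      rintro _ ⟨x, ⟨hx, hx1⟩, rfl⟩
      have := hL.dist_le_mul x hx x₀ hxV
      rw [Metric.mem_ball] at hx1
      rw [Metric.mem_closedBall]
      push_cast at this
      linarith
    have h2 := ((ℝ ∙ N)ᗮ.lipschitzWith_orthogonalProjectionOnto).isBounded_image h1
    rwa [image_image] at h2
  have hfin : volume (g '' (V ∩ Metric.ball x₀ 1)) ≠ ⊤ := hbdd.measure_lt_top.ne
  refine ⟨V ∩ Metric.ball x₀ 1, hVo.inter Metric.isOpen_ball, ⟨hxV, by simp⟩,
    2 ^ (finrank ℝ E - 1) * (volume (g '' (V ∩ Metric.ball x₀ 1))).toNNReal, fun y => ?_⟩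
  rw [ENNReal.coe_mul, ENNReal.coe_toNNReal hfin, ← hrank,
    ← InnerProductSpace.euclideanHausdorffMeasure_eq_volume]
  refine (euclideanHausdorffMeasure_le_image (c := 2) (g := g) ?_ _).trans ?_
  · rintro a ⟨⟨haV, -⟩, hay⟩ b ⟨⟨hbV, -⟩, hby⟩
    refine (hA a haV b hbV).trans_eq ?_
    congr 1
    -- On one level set of d the N-component of Θ is constant, so projecting along N preserves
    -- distances. Every slice thus injects, with the same constant, into one bounded set of
    -- dimension n - 1, whence a bound uniform in y.
    have hmem : Θ a - Θ b ∈ (ℝ ∙ N)ᗮ := by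
      rw [Submodule.mem_orthogonal_singleton_iff_inner_right, inner_sub_right, hΘ, hΘ]
      rw [mem_ofPred_eq] at hay hby
      rw [hay, hby, sub_self]
    rw [edist_dist, edist_dist, dist_eq_norm, dist_eq_norm, hg, ← map_sub,
      Submodule.norm_orthogonalProjectionOnto_apply _ hmem]
  · push_cast
    gcongr _ * ?_
    exact measure_mono (image_mono inter_subset_left)

end Coarea

/-! ### Half spaces and first-order behaviour along rays -/

section HalfSpace

variable {E : Type*} [NormedAddCommGroup E] [InnerProductSpace ℝ E]

/-- A linear functional that is nonnegative on an open half space is a nonnegative multiple of the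
functional defining the half space. -/
theorem exists_nonneg_smul_of_halfSpace {a b : E} (ha : a ≠ 0)
    (h : ∀ v : E, 0 < inner ℝ a v → 0 ≤ inner ℝ b v) : ∃ c : ℝ, 0 ≤ c ∧ b = c • a := by
  have ha2 : 0 < inner ℝ a a := real_inner_self_pos.2 ha
  set c : ℝ := inner ℝ b a / inner ℝ a a with hc
  set w : E := b - c • a with hw
  have haw : inner ℝ a w = 0 := by
    rw [hw, inner_sub_right, inner_smul_right, hc, div_mul_cancel₀ _ ha2.ne', real_inner_comm,
      sub_self]
  have hba : 0 ≤ inner ℝ b a := h a ha2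
  have hbw : inner ℝ b w = inner ℝ w w := by
    have : b = w + c • a := by simp [hw]
    conv_lhs => rw [this]
    rw [inner_add_left, inner_smul_left, haw]; simp
  -- The vector -w only lies on the boundary of the half space; adding ε • a moves it inside.
  have hle : ∀ ε : ℝ, 0 < ε → inner ℝ w w ≤ ε * inner ℝ b a := by
    intro ε hε
    have := h (ε • a - w) (by rw [inner_sub_right, inner_smul_right, haw]; simp; positivity)
    rw [inner_sub_right, inner_smul_right, hbw] at this
    linarith
  have hw0 : inner ℝ w w ≤ 0 := by
    have ht : Tendsto (fun ε : ℝ => ε * inner ℝ b a) (𝓝[>] 0) (𝓝 0) := by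
      have : Tendsto (fun ε : ℝ => ε * inner ℝ b a) (𝓝 0) (𝓝 (0 * inner ℝ b a)) :=
        tendsto_id.mul_const _
      rw [zero_mul] at this
      exact this.mono_left nhdsWithin_le_nhds
    exact ge_of_tendsto ht (eventually_nhdsWithin_of_forall fun ε hε => hle ε hε)
  have : w = 0 := by
    by_contra hne
    exact absurd (real_inner_self_pos.2 hne) (not_lt.2 hw0)
  exact ⟨c, div_nonneg hba ha2.le, by rw [← sub_eq_zero]; exact this⟩

theorem HasGradientAt.eventually_pos [CompleteSpace E] {ρ : E → ℝ} {b q v : E}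
    (hρ : HasGradientAt ρ b q) (h0 : ρ q = 0) (hv : 0 < inner ℝ b v) :
    ∀ᶠ s in 𝓝[>] (0 : ℝ), 0 < ρ (q + s • v) := by
  have hd : HasDerivAt (fun s : ℝ => ρ (q + s • v)) (inner ℝ b v) 0 := by
    have h1 : HasDerivAt (fun s : ℝ => q + s • v) v 0 := by
      simpa using ((hasDerivAt_id (0 : ℝ)).smul_const v).const_add q
    have h2 : HasFDerivAt ρ (InnerProductSpace.toDual ℝ E b) (q + (0 : ℝ) • v) := by
      simpa using hρ.hasFDerivAt
    simpa [Function.comp_def] using h2.comp_hasDerivAt (0 : ℝ) h1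
  have hs := (hasDerivAt_iff_tendsto_slope.1 hd).eventually (lt_mem_nhds hv)
  have hs' : ∀ᶠ s in 𝓝[>] (0 : ℝ), 0 < slope (fun s : ℝ => ρ (q + s • v)) 0 s :=
    hs.filter_mono (nhdsWithin_mono _ fun s hs => ne_of_gt hs)
  filter_upwards [hs', self_mem_nhdsWithin] with s hs hs0
  rw [slope_def_field] at hs
  simp only [zero_smul, add_zero, h0, sub_zero] at hs
  exact (div_pos_iff_of_pos_right hs0).1 hs

theorem HasGradientAt.eventually_neg [CompleteSpace E] {ρ : E → ℝ} {b q v : E}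
    (hρ : HasGradientAt ρ b q) (h0 : ρ q = 0) (hv : inner ℝ b v < 0) :
    ∀ᶠ s in 𝓝[>] (0 : ℝ), ρ (q + s • v) < 0 := by
  have h : HasGradientAt (fun x => - ρ x) (-b) q := by
    rw [hasGradientAt_iff_hasFDerivAt, map_neg]
    exact hρ.hasFDerivAt.neg
  filter_upwards [h.eventually_pos (v := v) (by simp [h0]) (by simpa using hv)] with s hs
  linarith

theorem eventually_mem_ball_of_inner_pos {x q v : E} (hv : 0 < inner ℝ (x - q) v) :
    ∀ᶠ s in 𝓝[>] (0 : ℝ), q + s • v ∈ Metric.ball x (dist x q) := by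
  have hpos : 0 < inner ℝ (x - q) v / (‖v‖ ^ 2 + 1) := by positivity
  filter_upwards [Ioo_mem_nhdsGT hpos] with s hs
  rw [Metric.mem_ball, dist_comm, dist_eq_norm, dist_eq_norm]
  refine lt_of_pow_lt_pow_left₀ 2 (norm_nonneg _) ?_
  rw [← sub_sub, norm_sub_sq_real, inner_smul_right, norm_smul, mul_pow, Real.norm_eq_abs, sq_abs]
  have h2 : s * (‖v‖ ^ 2 + 1) < inner ℝ (x - q) v := (lt_div_iff₀ (by positivity)).1 hs.2
  have h1 := hs.1
  nlinarith [mul_pos h1 hv, mul_lt_mul_of_pos_left h2 h1]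

end HalfSpace

/-! ### Outward normals and touching balls -/

section Normal

variable {n : ℕ} {Ω : Set (EuclideanSpace ℝ (Fin n))} {q x : EuclideanSpace ℝ (Fin n)}
  {ρ σ : EuclideanSpace ℝ (Fin n) → ℝ}

theorem IsLocalDefiningFunction.hasGradientAt (h : IsLocalDefiningFunction Ω q ρ) :
    HasGradientAt ρ (∇ ρ q) q := by
  obtain ⟨U, hU, hq, hρ, -, -⟩ := h
  exact ((hρ.contDiffAt (hU.mem_nhds hq)).differentiableAt (by simp)).hasGradientAt

theorem IsLocalDefiningFunction.gradient_ne_zero (h : IsLocalDefiningFunction Ω q ρ) :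
    ∇ ρ q ≠ 0 := by
  obtain ⟨U, -, hq, -, h, -⟩ := h
  exact h q hq

theorem IsLocalDefiningFunction.eventually_mem_iff (h : IsLocalDefiningFunction Ω q ρ) :
    ∀ᶠ z in 𝓝 q, z ∈ Ω ↔ ρ z < 0 := by
  obtain ⟨U, hU, hq, -, -, h⟩ := h
  exact eventually_of_mem (hU.mem_nhds hq) h

theorem IsLocalDefiningFunction.eventually_ray (h : IsLocalDefiningFunction Ω q ρ)
    (v : EuclideanSpace ℝ (Fin n)) :
    ∀ᶠ s in 𝓝[>] (0 : ℝ), q + s • v ∈ Ω ↔ ρ (q + s • v) < 0 := by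
  have : Tendsto (fun s : ℝ => q + s • v) (𝓝[>] 0) (𝓝 q) := by
    have : Tendsto (fun s : ℝ => q + s • v) (𝓝 0) (𝓝 (q + (0 : ℝ) • v)) :=
      Continuous.tendsto (by fun_prop) _
    simp only [zero_smul, add_zero] at this
    exact this.mono_left nhdsWithin_le_nhds
  exact this.eventually h.eventually_mem_iff

theorem IsLocalDefiningFunction.eq_zero (h : IsLocalDefiningFunction Ω q ρ) (hΩ : IsOpen Ω)
    (hq : q ∈ frontier Ω) : ρ q = 0 := by
  rw [hΩ.frontier_eq] at hq
  refine le_antisymm ?_ ?_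
  · by_contra! hpos
    have h1 := h.hasGradientAt.differentiableAt.continuousAt.eventually (lt_mem_nhds hpos)
    have h2 := (h1.and h.eventually_mem_iff)
    obtain ⟨z, hzΩ, hz1, hz2⟩ := ((mem_closure_iff_frequently.1 hq.1).and_eventually h2).exists
    exact absurd (hz2.1 hzΩ) (not_lt.2 hz1.le)
  · by_contra! hneg
    exact hq.2 (h.eventually_mem_iff.self_of_nhds.2 hneg)

theorem inv_norm_smul_smul {E : Type*} [NormedAddCommGroup E] [NormedSpace ℝ E] {c : ℝ}
    (hc : 0 < c) (a : E) : ‖c • a‖⁻¹ • c • a = ‖a‖⁻¹ • a := by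
  rw [norm_smul, Real.norm_of_nonneg hc.le, smul_smul, mul_inv, mul_right_comm,
    inv_mul_cancel₀ hc.ne', one_mul]

theorem norm_inv_norm_smul {E : Type*} [NormedAddCommGroup E] [NormedSpace ℝ E] {a : E}
    (ha : a ≠ 0) : ‖‖a‖⁻¹ • a‖ = 1 := by
  rw [norm_smul, norm_inv, norm_norm, inv_mul_cancel₀ (norm_ne_zero_iff.2 ha)]

/-- The outward unit normal does not depend on the local defining function. -/
theorem IsLocalDefiningFunction.unitNormal_eq (hρ : IsLocalDefiningFunction Ω q ρ)
    (hσ : IsLocalDefiningFunction Ω q σ) (hΩ : IsOpen Ω) (hq : q ∈ frontier Ω) :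
    ‖∇ ρ q‖⁻¹ • ∇ ρ q = ‖∇ σ q‖⁻¹ • ∇ σ q := by
  -- A direction v along which ρ increases and σ decreases would put q + s • v both outside and
  -- inside Ω for small s > 0.
  obtain ⟨c, hc, h⟩ := exists_nonneg_smul_of_halfSpace (b := ∇ σ q) hρ.gradient_ne_zero
    (fun v hv => by
      by_contra! hneg
      obtain ⟨s, h1, h2, h3, h4⟩ := ((hρ.hasGradientAt.eventually_pos (hρ.eq_zero hΩ hq) hv).and
        ((hσ.hasGradientAt.eventually_neg (hσ.eq_zero hΩ hq) hneg).and
        ((hρ.eventually_ray v).and (hσ.eventually_ray v)))).exists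
      exact absurd (h3.1 (h4.2 h2)) (not_lt.2 h1.le))
  have hc0 : 0 < c := by
    refine lt_of_le_of_ne hc fun h0 => hσ.gradient_ne_zero ?_
    rw [h, ← h0, zero_smul]
  rw [h, inv_norm_smul_smul hc0]

theorem IsLocalDefiningFunction.outwardUnitNormal_eq (hρ : IsLocalDefiningFunction Ω q ρ)
    (hΩ : IsOpen Ω) (hq : q ∈ frontier Ω) :
    outwardUnitNormal Ω q = ‖∇ ρ q‖⁻¹ • ∇ ρ q := by
  have hex : ∃ ν, IsOutwardUnitNormal Ω q ν := ⟨_, ρ, hρ, rfl⟩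
  rw [outwardUnitNormal, dif_pos hex]
  obtain ⟨σ, hσ, h⟩ := hex.choose_spec
  rw [h]
  exact hσ.unitNormal_eq hρ hΩ hq

/-- The ball touches ∂Ω at q from outside. Directions entering it cannot decrease ρ to first order,
so ∇ρ(q) is a positive multiple of x - q. -/
theorem IsLocalDefiningFunction.eq_add_smul_of_ball_subset_compl
    (h : IsLocalDefiningFunction Ω q ρ) (hΩ : IsOpen Ω) (hq : q ∈ frontier Ω)
    (hball : Metric.ball x (dist x q) ⊆ Ωᶜ) :
    x = q + dist x q • ‖∇ ρ q‖⁻¹ • ∇ ρ q := by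
  rcases eq_or_ne x q with rfl | hne
  · simp
  obtain ⟨c, hc, hcx⟩ := exists_nonneg_smul_of_halfSpace (b := ∇ ρ q) (sub_ne_zero.2 hne)
    (fun v hv => by
      by_contra! hneg
      obtain ⟨s, h1, h2, h3⟩ := ((eventually_mem_ball_of_inner_pos hv).and
        ((h.hasGradientAt.eventually_neg (h.eq_zero hΩ hq) hneg).and (h.eventually_ray v))).exists
      exact hball h1 (h3.2 h2))
  have hc0 : 0 < c := by
    refine lt_of_le_of_ne hc fun h0 => h.gradient_ne_zero ?_
    rw [hcx, ← h0, zero_smul]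
  rw [hcx, inv_norm_smul_smul hc0, dist_eq_norm, smul_smul,
    mul_inv_cancel₀ (norm_ne_zero_iff.2 (sub_ne_zero.2 hne)), one_smul, add_sub_cancel]

theorem IsLocalDefiningFunction.eq_sub_smul_of_ball_subset
    (h : IsLocalDefiningFunction Ω q ρ) (hΩ : IsOpen Ω) (hq : q ∈ frontier Ω)
    (hball : Metric.ball x (dist x q) ⊆ Ω) :
    x = q - dist x q • ‖∇ ρ q‖⁻¹ • ∇ ρ q := by
  rcases eq_or_ne x q with rfl | hne
  · simp
  obtain ⟨c, hc, hcx⟩ := exists_nonneg_smul_of_halfSpace (b := -∇ ρ q) (sub_ne_zero.2 hne)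
    (fun v hv => by
      by_contra! hneg
      rw [inner_neg_left, neg_lt_zero] at hneg
      obtain ⟨s, h1, h2, h3⟩ := ((eventually_mem_ball_of_inner_pos hv).and
        ((h.hasGradientAt.eventually_pos (h.eq_zero hΩ hq) hneg).and (h.eventually_ray v))).exists
      exact absurd (h3.1 (hball h1)) (not_lt.2 h2.le))
  have hc0 : 0 < c := by
    refine lt_of_le_of_ne hc fun h0 => h.gradient_ne_zero ?_
    rw [← neg_eq_zero, hcx, ← h0, zero_smul]
  have h1 : ‖∇ ρ q‖⁻¹ • ∇ ρ q = -(‖x - q‖⁻¹ • (x - q)) := by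
    rw [← inv_norm_smul_smul hc0 (x - q), ← hcx, norm_neg, smul_neg, neg_neg]
  rw [h1, dist_eq_norm, smul_neg, smul_smul,
    mul_inv_cancel₀ (norm_ne_zero_iff.2 (sub_ne_zero.2 hne)), one_smul, sub_neg_eq_add,
    add_sub_cancel]

end Normal

/-! ### Signed distance and foot points -/

section SignedDistance

variable {n : ℕ} {Ω : Set (EuclideanSpace ℝ (Fin n))}

theorem continuous_signedInfDist : Continuous (signedInfDist Ω) :=
  (Metric.continuous_infDist_pt Ω).sub (Metric.continuous_infDist_pt Ωᶜ)

/-- Every point is reached from a boundary point along the normal, at signed distance. -/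
theorem exists_foot_signedInfDist (hΩ : IsOpen Ω) (hne : Ω.Nonempty) (hne' : Ω ≠ univ)
    (x : EuclideanSpace ℝ (Fin n)) :
    ∃ q ∈ frontier Ω, dist x q = |signedInfDist Ω x| ∧ ∀ ρ, IsLocalDefiningFunction Ω q ρ →
      x = q + signedInfDist Ω x • ‖∇ ρ q‖⁻¹ • ∇ ρ q := by
  by_cases hx : x ∈ Ω
  · obtain ⟨q, hq, hqd⟩ := exists_mem_frontier_infDist_compl_eq_dist hx hne'
    have hd : signedInfDist Ω x = - dist x q := by
      rw [signedInfDist, Metric.infDist_zero_of_mem hx, hqd, zero_sub]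
    refine ⟨q, hq, by rw [hd, abs_neg, abs_of_nonneg dist_nonneg], fun ρ hρ => ?_⟩
    rw [hd, neg_smul, ← sub_eq_add_neg]
    refine hρ.eq_sub_smul_of_ball_subset hΩ hq ?_
    rw [← hqd]
    exact Metric.ball_infDist_compl_subset
  · have hxc : Metric.infDist x Ωᶜ = 0 := Metric.infDist_zero_of_mem hx
    suffices h : ∃ q ∈ frontier Ω, Metric.infDist x Ω = dist x q by
      obtain ⟨q, hq, hqd⟩ := h
      have hd : signedInfDist Ω x = dist x q := by rw [signedInfDist, hxc, hqd, sub_zero]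
      refine ⟨q, hq, by rw [hd, abs_of_nonneg dist_nonneg], fun ρ hρ => ?_⟩
      rw [hd]
      refine hρ.eq_add_smul_of_ball_subset_compl hΩ hq ?_
      rw [← hqd]
      exact Metric.ball_infDist_subset_compl
    -- A boundary point is its own foot; a point off the closure takes a nearest point of the
    -- closure.
    by_cases hxcl : x ∈ closure Ω
    · refine ⟨x, hΩ.frontier_eq ▸ ⟨hxcl, hx⟩, ?_⟩
      rw [← Metric.infDist_closure, Metric.infDist_zero_of_mem hxcl, dist_self]
    · have hs : (closure Ω)ᶜ ≠ univ := by
        rw [Ne, compl_univ_iff]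
        exact hne.closure.ne_empty
      obtain ⟨q, hq, hqd⟩ := exists_mem_frontier_infDist_compl_eq_dist (mem_compl hxcl) hs
      rw [compl_compl, Metric.infDist_closure] at hqd
      rw [frontier_compl] at hq
      exact ⟨q, frontier_closure_subset hq, hqd⟩

theorem signedInfDist_eq_zero_of_mem_frontier (hΩ : IsOpen Ω) {x : EuclideanSpace ℝ (Fin n)}
    (hx : x ∈ frontier Ω) : signedInfDist Ω x = 0 := by
  rw [hΩ.frontier_eq] at hx
  rw [signedInfDist, ← Metric.infDist_closure, Metric.infDist_zero_of_mem hx.1,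
    Metric.infDist_zero_of_mem (show x ∈ Ωᶜ from hx.2), sub_self]

end SignedDistance

/-! ### Smoothness of the signed distance near the boundary -/

section Tube

variable {n : ℕ} {Ω : Set (EuclideanSpace ℝ (Fin n))}

theorem contDiffOn_gradient {E : Type*} [NormedAddCommGroup E] [InnerProductSpace ℝ E]
    [CompleteSpace E] {ρ : E → ℝ} {U : Set E} (hU : IsOpen U) (hρ : ContDiffOn ℝ ∞ ρ U) :
    ContDiffOn ℝ ∞ (∇ ρ) U := by
  have h1 : ContDiffOn ℝ ∞ (fderiv ℝ ρ) U := hρ.fderiv_of_isOpen hU (by simp)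
  exact (InnerProductSpace.toDual ℝ E).symm.contDiff.comp_contDiffOn h1

theorem contDiffOn_unitNormal {E : Type*} [NormedAddCommGroup E] [InnerProductSpace ℝ E]
    [CompleteSpace E] {ρ : E → ℝ} {U : Set E} (hU : IsOpen U) (hρ : ContDiffOn ℝ ∞ ρ U)
    (h0 : ∀ z ∈ U, ∇ ρ z ≠ 0) : ContDiffOn ℝ ∞ (fun z => ‖∇ ρ z‖⁻¹ • ∇ ρ z) U := by
  have h1 := contDiffOn_gradient hU hρ
  exact ((h1.norm ℝ h0).inv fun z hz => norm_ne_zero_iff.2 (h0 z hz)).smul h1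

/-- The linear map `(v, μ) ↦ (v + μ N, ⟨a, v⟩)` is invertible if `⟨a, N⟩ ≠ 0`. -/
theorem exists_equiv_of_normal {E : Type*} [NormedAddCommGroup E] [InnerProductSpace ℝ E]
    [FiniteDimensional ℝ E] {a N : E} (haN : inner ℝ a N ≠ 0) :
    ∃ e : (E × ℝ) ≃L[ℝ] (E × ℝ), ∀ v : E × ℝ, e v = (v.1 + v.2 • N, inner ℝ a v.1) := by
  let L : (E × ℝ) →ₗ[ℝ] (E × ℝ) :=
    { toFun := fun v => (v.1 + v.2 • N, inner ℝ a v.1)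
      map_add' := fun v w => by
        ext1
        · simp only [Prod.fst_add, Prod.snd_add, add_smul]; abel
        · simp [inner_add_right]
      map_smul' := fun c v => by
        ext1
        · simp [smul_smul]
        · simp [inner_smul_right] }
  have hinj : Function.Injective L := by
    rw [injective_iff_map_eq_zero]
    intro v hv
    have h1 : v.1 + v.2 • N = 0 := congrArg Prod.fst hv
    have h2 : inner ℝ a v.1 = 0 := congrArg Prod.snd hv
    have h3 : v.2 * inner ℝ a N = 0 := by
      have := congrArg (inner ℝ a) h1
      rwa [inner_add_right, h2, inner_smul_right, zero_add, inner_zero_right] at this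
    have h4 : v.2 = 0 := (mul_eq_zero.1 h3).resolve_right haN
    rw [h4, zero_smul, add_zero] at h1
    exact Prod.ext h1 h4
  exact ⟨(LinearEquiv.ofInjectiveEndo L hinj).toContinuousLinearEquiv, fun v => rfl⟩

theorem isLocalDefiningFunction_of_mem {U : Set (EuclideanSpace ℝ (Fin n))}
    {ρ : EuclideanSpace ℝ (Fin n) → ℝ} (hU : IsOpen U) (hρ : ContDiffOn ℝ ∞ ρ U)
    (h0 : ∀ z ∈ U, ∇ ρ z ≠ 0) (hΩ : ∀ z ∈ U, z ∈ Ω ↔ ρ z < 0) {q : EuclideanSpace ℝ (Fin n)}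
    (hq : q ∈ U) : IsLocalDefiningFunction Ω q ρ := ⟨U, hU, hq, hρ, h0, hΩ⟩

/-- If `x = P x + d x • N (P x)` with `N` a unit field normal to the level set of `ρ` in which `P`
takes its values, then `N (P x)` is the gradient of `d` at `x`. -/
theorem hasGradientAt_of_normal_coordinates {E : Type*} [NormedAddCommGroup E]
    [InnerProductSpace ℝ E] [CompleteSpace E] {ρ d : E → ℝ} {P N : E → E} {x : E}
    (hP : DifferentiableAt ℝ P x) (hd : DifferentiableAt ℝ d x) (hN : DifferentiableAt ℝ N (P x))
    (hρ : DifferentiableAt ℝ ρ (P x)) (hunit : ∀ᶠ z in 𝓝 (P x), ‖N z‖ = 1)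
    (hNρ : ∃ c : ℝ, N (P x) = c • ∇ ρ (P x)) (hPρ : ∀ᶠ z in 𝓝 x, ρ (P z) = 0)
    (hx : ∀ᶠ z in 𝓝 x, P z + d z • N (P z) = z) : HasGradientAt d (N (P x)) x := by
  have hP' := hP.hasFDerivAt
  have hd' := hd.hasFDerivAt
  have hN' := hN.hasFDerivAt
  have h1 : ∀ v, inner ℝ (N (P x)) (fderiv ℝ P x v) = 0 := by
    intro v
    have hc : HasFDerivAt (fun z => ρ (P z)) ((fderiv ℝ ρ (P x)).comp (fderiv ℝ P x)) x :=
      hρ.hasFDerivAt.comp x hP'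
    have hz : HasFDerivAt (fun z => ρ (P z)) (0 : E →L[ℝ] ℝ) x :=
      (hasFDerivAt_const (0 : ℝ) x).congr_of_eventuallyEq hPρ
    have := congrArg (fun L : E →L[ℝ] ℝ => L v) (hc.unique hz)
    obtain ⟨c, hc⟩ := hNρ
    rw [hc, inner_smul_left, inner_gradient_left]
    simp only [ContinuousLinearMap.comp_apply, zero_apply] at this
    rw [this, mul_zero]
  have h2 : ∀ w, inner ℝ (N (P x)) (fderiv ℝ N (P x) w) = 0 := by
    intro w
    have hc := hN'.inner ℝ hN'
    have hz : HasFDerivAt (fun z => inner ℝ (N z) (N z)) (0 : E →L[ℝ] ℝ) (P x) := by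
      refine (hasFDerivAt_const (1 : ℝ) (P x)).congr_of_eventuallyEq ?_
      filter_upwards [hunit] with z hz
      rw [real_inner_self_eq_norm_sq, hz, one_pow]
    have := congrArg (fun L : E →L[ℝ] ℝ => L w) (hc.unique hz)
    simp only [ContinuousLinearMap.comp_apply, ContinuousLinearMap.prod_apply,
      fderivInnerCLM_apply, zero_apply] at this
    rw [real_inner_comm (N (P x))] at this
    linarith
  have h3 := hP'.add (hd'.smul (hN'.comp x hP'))
  have h4 : HasFDerivAt (fun z => P z + d z • N (P z)) (ContinuousLinearMap.id ℝ E) x :=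
    (hasFDerivAt_id x).congr_of_eventuallyEq hx
  rw [hasGradientAt_iff_hasFDerivAt]
  refine hd'.congr_fderiv ?_
  ext v
  -- Pairing the differentiated identity with N removes the derivative of P, tangent to the level
  -- set, and that of N, orthogonal to N by unit length. Only the derivative of d survives.
  have h5 := congrArg (fun L : E →L[ℝ] E => inner ℝ (N (P x)) (L v)) (h3.unique h4)
  simp only [add_apply, smul_apply,
    ContinuousLinearMap.comp_apply, ContinuousLinearMap.smulRight_apply,
    ContinuousLinearMap.id_apply, Function.comp_apply, inner_add_right, inner_smul_right,
    h1, h2, mul_zero, zero_add, real_inner_self_eq_norm_sq, hunit.self_of_nhds, one_pow,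
    mul_one] at h5
  rw [h5, InnerProductSpace.toDual_apply_apply]

/-- Near a smooth boundary point the signed distance is smooth, with gradient of norm one. -/
theorem IsLocalDefiningFunction.exists_nhds_signedInfDist (hΩ : IsOpen Ω) (hne' : Ω ≠ univ)
    {x₀ : EuclideanSpace ℝ (Fin n)} (hx₀ : x₀ ∈ frontier Ω) {ρ : EuclideanSpace ℝ (Fin n) → ℝ}
    (h : IsLocalDefiningFunction Ω x₀ ρ) :
    ∃ V : Set (EuclideanSpace ℝ (Fin n)), IsOpen V ∧ x₀ ∈ V ∧ ∀ x ∈ V,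
      ContDiffAt ℝ ∞ (signedInfDist Ω) x ∧ ‖∇ (signedInfDist Ω) x‖ = 1 := by
  have hρ₀ := h.eq_zero hΩ hx₀
  have hgrad₀ := h.gradient_ne_zero
  have hne : Ω.Nonempty := by
    rw [← closure_nonempty_iff]; exact ⟨x₀, frontier_subset_closure hx₀⟩
  obtain ⟨U, hU, hxU, hρ, h0, hΩU⟩ := h
  set N : EuclideanSpace ℝ (Fin n) → EuclideanSpace ℝ (Fin n) :=
    fun z => ‖∇ ρ z‖⁻¹ • ∇ ρ z with hN
  have hNs : ContDiffOn ℝ ∞ N U := contDiffOn_unitNormal hU hρ h0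
  -- Recording ρ as an extra coordinate avoids charts of ∂Ω: the normal coordinates (q, s) of a
  -- point x near the boundary solve Ψ(q, s) = (x, 0).
  set Ψ : EuclideanSpace ℝ (Fin n) × ℝ → EuclideanSpace ℝ (Fin n) × ℝ :=
    fun z => (z.1 + z.2 • N z.1, ρ z.1) with hΨ
  have hΨs : ∀ z : EuclideanSpace ℝ (Fin n) × ℝ, z.1 ∈ U → ContDiffAt ℝ ∞ Ψ z := by
    intro z hz
    have h1 : ContDiffAt ℝ ∞ (fun z : EuclideanSpace ℝ (Fin n) × ℝ => N z.1) z :=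
      (hNs.contDiffAt (hU.mem_nhds hz)).comp z contDiffAt_fst
    have h2 : ContDiffAt ℝ ∞ (fun z : EuclideanSpace ℝ (Fin n) × ℝ => ρ z.1) z :=
      (hρ.contDiffAt (hU.mem_nhds hz)).comp z contDiffAt_fst
    exact (contDiffAt_fst.add (contDiffAt_snd.smul h1)).prodMk h2
  obtain ⟨e₀, he₀⟩ := exists_equiv_of_normal (a := ∇ ρ x₀) (N := N x₀) (by
    rw [hN, inner_smul_right, real_inner_self_eq_norm_sq]
    have := norm_ne_zero_iff.2 hgrad₀
    positivity)
  have hder : HasFDerivAt Ψ (e₀ : _ →L[ℝ] _) (x₀, 0) := by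
    have hN' : DifferentiableAt ℝ N x₀ :=
      (hNs.contDiffAt (hU.mem_nhds hxU)).differentiableAt (by simp)
    have hρ' : DifferentiableAt ℝ ρ x₀ :=
      (hρ.contDiffAt (hU.mem_nhds hxU)).differentiableAt (by simp)
    have hf : HasFDerivAt (fun z : EuclideanSpace ℝ (Fin n) × ℝ => z.1)
      (ContinuousLinearMap.fst ℝ _ _) (x₀, (0 : ℝ)) := hasFDerivAt_fst
    have hs : HasFDerivAt (fun z : EuclideanSpace ℝ (Fin n) × ℝ => z.2)
      (ContinuousLinearMap.snd ℝ _ _) (x₀, (0 : ℝ)) := hasFDerivAt_snd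
    have h1 : HasFDerivAt (fun z : EuclideanSpace ℝ (Fin n) × ℝ => N z.1) _ (x₀, (0 : ℝ)) :=
      HasFDerivAt.comp (x₀, (0 : ℝ)) (f := Prod.fst) hN'.hasFDerivAt hf
    have h2 : HasFDerivAt (fun z : EuclideanSpace ℝ (Fin n) × ℝ => ρ z.1) _ (x₀, (0 : ℝ)) :=
      HasFDerivAt.comp (x₀, (0 : ℝ)) (f := Prod.fst) hρ'.hasFDerivAt hf
    refine ((hf.add (hs.smul h1)).prodMk h2).congr_fderiv ?_
    refine ContinuousLinearMap.ext fun v => ?_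
    rw [ContinuousLinearEquiv.coe_coe, he₀, inner_gradient_left]
    simp
  set φ := (hΨs (x₀, 0) hxU).toOpenPartialHomeomorph Ψ hder (by simp) with hφ
  have hφΨ : ∀ z, φ z = Ψ z := fun z => rfl
  have hmem : ((x₀, 0) : EuclideanSpace ℝ (Fin n) × ℝ) ∈ φ.source :=
    (hΨs (x₀, 0) hxU).mem_toOpenPartialHomeomorph_source hder (by simp)
  -- The inverse must be smooth on a neighbourhood, so the derivative has to be invertible near (x₀,
  -- 0) and not only there.
  have hinv : ∀ᶠ z in 𝓝 ((x₀, 0) : EuclideanSpace ℝ (Fin n) × ℝ),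
      fderiv ℝ Ψ z ∈ range ((↑) : ((EuclideanSpace ℝ (Fin n) × ℝ) ≃L[ℝ]
        (EuclideanSpace ℝ (Fin n) × ℝ)) → _) := by
    have hc : ContinuousAt (fderiv ℝ Ψ) (x₀, 0) :=
      ((hΨs (x₀, 0) hxU).fderiv_right (m := 0) (by simp)).continuousAt
    refine hc.eventually_mem ?_
    rw [hder.fderiv]
    exact e₀.nhds
  have hgood : ∀ᶠ z in 𝓝 ((x₀, 0) : EuclideanSpace ℝ (Fin n) × ℝ), z.1 ∈ U ∧ z ∈ φ.source ∧
      fderiv ℝ Ψ z ∈ range ((↑) : ((EuclideanSpace ℝ (Fin n) × ℝ) ≃L[ℝ]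
        (EuclideanSpace ℝ (Fin n) × ℝ)) → _) :=
    (continuousAt_fst.eventually_mem (hU.mem_nhds hxU)).and
      ((φ.open_source.eventually_mem hmem).and hinv)
  obtain ⟨r, hr, hrg⟩ := Metric.eventually_nhds_iff.1 hgood
  set d := signedInfDist Ω with hd
  have hdc : Continuous d := continuous_signedInfDist
  have hd₀ : d x₀ = 0 := signedInfDist_eq_zero_of_mem_frontier hΩ hx₀
  -- The foot q of x lies at distance |d x| from x, so the two halves keep q within r of x₀. There
  -- the local inverse is injective, so it must return the pair (q, d x).
  set V : Set (EuclideanSpace ℝ (Fin n)) := Metric.ball x₀ (r / 2) ∩ {x | |d x| < r / 2} with hV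
  have hVo : IsOpen V := Metric.isOpen_ball.inter (isOpen_lt hdc.abs continuous_const)
  have hfoot : ∀ x ∈ V, ∃ q, (q ∈ U ∧ (q, d x) ∈ φ.source ∧
      fderiv ℝ Ψ (q, d x) ∈ range ((↑) : ((EuclideanSpace ℝ (Fin n) × ℝ) ≃L[ℝ]
        (EuclideanSpace ℝ (Fin n) × ℝ)) → _)) ∧ Ψ (q, d x) = (x, 0) := by
    rintro x ⟨hx1, hx2⟩
    obtain ⟨q, hq, hqd, hqx⟩ := exists_foot_signedInfDist hΩ hne hne' x
    have hdist : dist (q, d x) (x₀, 0) < r := by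
      rw [Prod.dist_eq, max_lt_iff]
      rw [Metric.mem_ball] at hx1
      rw [mem_ofPred_eq] at hx2
      constructor
      · calc dist q x₀ ≤ dist q x + dist x x₀ := dist_triangle _ _ _
          _ < r / 2 + r / 2 := by
            rw [dist_comm q x, hqd]; exact add_lt_add hx2 hx1
          _ = r := by ring
      · rw [Real.dist_eq, sub_zero]; exact hx2.trans (by linarith)
    have hg := hrg hdist
    have hρq := isLocalDefiningFunction_of_mem hU hρ h0 hΩU hg.1
    refine ⟨q, hg, ?_⟩
    rw [hΨ]
    exact Prod.ext (hqx ρ hρq).symm (hρq.eq_zero hΩ hq)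
  have hsymm : ∀ x ∈ V, ((x, 0) : EuclideanSpace ℝ (Fin n) × ℝ) ∈ φ.target ∧
      (φ.symm (x, 0)).1 ∈ U ∧ (φ.symm (x, 0)).2 = d x ∧ Ψ (φ.symm (x, 0)) = (x, 0) ∧
      ContDiffAt ℝ ∞ φ.symm (x, 0) := by
    intro x hx
    obtain ⟨q, ⟨hqU, hqs, f', hf'⟩, hq⟩ := hfoot x hx
    have h1 : φ.symm (x, 0) = (q, d x) := by rw [← hq, ← hφΨ, φ.left_inv hqs]
    have h2 : ((x, 0) : EuclideanSpace ℝ (Fin n) × ℝ) ∈ φ.target := by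
      rw [← hq, ← hφΨ]; exact φ.map_source hqs
    have h3 : ContDiffAt ℝ ∞ φ (φ.symm (x, 0)) := by rw [h1]; exact hΨs _ hqU
    refine ⟨h2, by rwa [h1], by rw [h1], by rw [h1, hq], φ.contDiffAt_symm h2 (f₀' := f') ?_ h3⟩
    rw [hf', h1]
    exact ((hΨs _ hqU).differentiableAt (by simp)).hasFDerivAt
  refine ⟨V, hVo, ⟨by simp [hr], by simp [hd₀, hr]⟩, fun x hx => ?_⟩
  obtain ⟨-, hPU, -, -, hsm⟩ := hsymm x hx
  have hcomp : ContDiffAt ℝ ∞ (fun z => φ.symm (z, (0 : ℝ))) x :=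
    ContDiffAt.comp x (f := fun z => (z, (0 : ℝ))) hsm (contDiffAt_id.prodMk contDiffAt_const)
  have hVx : ∀ᶠ z in 𝓝 x, z ∈ V := hVo.mem_nhds hx
  have hds : ContDiffAt ℝ ∞ d x := by
    refine (contDiffAt_snd.comp x hcomp).congr_of_eventuallyEq ?_
    filter_upwards [hVx] with z hz
    exact (hsymm z hz).2.2.1.symm
  refine ⟨hds, ?_⟩
  have hgr : HasGradientAt d (N (φ.symm (x, 0)).1) x := by
    refine hasGradientAt_of_normal_coordinates (ρ := ρ) (P := fun z => (φ.symm (z, 0)).1)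
      ((contDiffAt_fst.comp x hcomp).differentiableAt (by simp)) (hds.differentiableAt (by simp))
      ((hNs.contDiffAt (hU.mem_nhds hPU)).differentiableAt (by simp))
      ((hρ.contDiffAt (hU.mem_nhds hPU)).differentiableAt (by simp)) ?_ ⟨_, rfl⟩ ?_ ?_
    · filter_upwards [hU.mem_nhds hPU] with z hz
      exact norm_inv_norm_smul (h0 z hz)
    · filter_upwards [hVx] with z hz
      exact congrArg Prod.snd (hsymm z hz).2.2.2.1
    · filter_upwards [hVx] with z hz
      rw [← (hsymm z hz).2.2.1]
      exact congrArg Prod.fst (hsymm z hz).2.2.2.1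
  rw [hgr.gradient]
  exact norm_inv_norm_smul (h0 _ hPU)

end Tube

/-! ### Parallel surfaces and their surface measures -/

section Foliation

open ProbabilityTheory
open scoped ENNReal

variable {n : ℕ} {Ω : Set (EuclideanSpace ℝ (Fin n))}

theorem ContDiffAt.hasStrictFDerivAt_innerSL_gradient {E : Type*} [NormedAddCommGroup E]
    [InnerProductSpace ℝ E] [CompleteSpace E] {d : E → ℝ} {x : E} (hd : ContDiffAt ℝ ∞ d x) :
    HasStrictFDerivAt d (innerSL ℝ (∇ d x)) x := by
  refine (hd.hasStrictFDerivAt (by simp)).congr_fderiv ?_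
  ext v
  rw [innerSL_apply_apply, inner_gradient_left]

/-- Tubular neighbourhood of the boundary of a smooth bounded domain. -/
theorem IsSmoothBoundedDomain.exists_tube (hΩ : IsSmoothBoundedDomain Ω) (hne : Ω.Nonempty)
    (hne' : Ω ≠ univ) :
    ∃ δ : ℝ, 0 < δ ∧ (∀ x, |signedInfDist Ω x| < δ →
      ContDiffAt ℝ ∞ (signedInfDist Ω) x ∧ ‖∇ (signedInfDist Ω) x‖ = 1) ∧
      ∃ C : ℝ≥0, ∀ y, |y| < δ →
        Measure.euclideanHausdorffMeasure (n - 1) {x | signedInfDist Ω x = y} ≤ C := by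
  have hloc : ∀ x ∈ frontier Ω, ∃ V : Set (EuclideanSpace ℝ (Fin n)), IsOpen V ∧ x ∈ V ∧
      (∀ z ∈ V, ContDiffAt ℝ ∞ (signedInfDist Ω) z ∧ ‖∇ (signedInfDist Ω) z‖ = 1) ∧
      ∃ C : ℝ≥0, ∀ y, Measure.euclideanHausdorffMeasure (n - 1)
        (V ∩ {x | signedInfDist Ω x = y}) ≤ C := by
    intro x hx
    obtain ⟨ρ, hρ⟩ := hΩ.smooth_boundary x hx
    obtain ⟨V, hVo, hxV, hV⟩ := hρ.exists_nhds_signedInfDist hΩ.isOpen hne' hx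
    obtain ⟨W, hWo, hxW, C, hC⟩ := exists_nhds_slice_le (hV x hxV).2
      (ContDiffAt.hasStrictFDerivAt_innerSL_gradient (hV x hxV).1)
    rw [finrank_euclideanSpace_fin] at hC
    exact ⟨V ∩ W, hVo.inter hWo, ⟨hxV, hxW⟩, fun z hz => hV z hz.1, C, fun y =>
      (measure_mono (inter_subset_inter_left _ inter_subset_right)).trans (hC y)⟩
  choose! V hVo hxV hV C hC using hloc
  have hcomp : IsCompact (frontier Ω) := Metric.isCompact_of_isClosed_isBounded isClosed_frontier
    (hΩ.isBounded.closure.subset frontier_subset_closure)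
  obtain ⟨t, ht, htV⟩ := hcomp.elim_nhds_subcover V fun x hx => (hVo x hx).mem_nhds (hxV x hx)
  -- A point with |d| < δ has its foot on ∂Ω at distance |d|, so it lies in the δ-thickening and
  -- thereby in the finite cover.
  obtain ⟨δ, hδ, hδV⟩ := hcomp.exists_thickening_subset_open
    (isOpen_biUnion fun x hx => hVo x (ht x hx)) htV
  have hsub : ∀ x, |signedInfDist Ω x| < δ → x ∈ ⋃ z ∈ t, V z := by
    intro x hx
    obtain ⟨q, hq, hqd, -⟩ := exists_foot_signedInfDist hΩ.isOpen hne hne' x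
    exact hδV (Metric.mem_thickening_iff.2 ⟨q, hq, hqd ▸ hx⟩)
  refine ⟨δ, hδ, fun x hx => ?_, ∑ x ∈ t, C x, fun y hy => ?_⟩
  · obtain ⟨z, hz, hxz⟩ := mem_iUnion₂.1 (hsub x hx)
    exact hV z (ht z hz) x hxz
  · have h1 : {x | signedInfDist Ω x = y} ⊆ ⋃ z ∈ t, (V z ∩ {x | signedInfDist Ω x = y}) := by
      intro x hx
      rw [mem_ofPred_eq] at hx
      obtain ⟨z, hz, hxz⟩ := mem_iUnion₂.1 (hsub x (by rwa [hx]))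
      exact mem_iUnion₂.2 ⟨z, hz, hxz, hx⟩
    refine (measure_mono h1).trans ((measure_biUnion_finset_le _ _).trans ?_)
    rw [ENNReal.ofNNReal_finsetSum]
    exact Finset.sum_le_sum fun x hx => hC x (ht x hx) y

theorem isOpen_parallelDomain (y : ℝ) : IsOpen (parallelDomain Ω y) :=
  isOpen_lt continuous_signedInfDist continuous_const

theorem isBounded_parallelDomain (hb : Bornology.IsBounded Ω) (hne : Ω.Nonempty) (y : ℝ) :
    Bornology.IsBounded (parallelDomain Ω y) := by
  refine (hb.thickening (δ := max y 0 + 1)).subset fun x hx => ?_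
  rw [Metric.mem_thickening_iff_infDist_lt hne]
  rcases le_or_gt (Metric.infDist x Ωᶜ) 0 with h | h
  · have : Metric.infDist x Ω - Metric.infDist x Ωᶜ < y := hx
    linarith [le_max_left y 0]
  · have hxΩ : x ∈ Ω := by
      by_contra hc
      exact h.ne' (Metric.infDist_zero_of_mem (show x ∈ Ωᶜ from hc))
    rw [Metric.infDist_zero_of_mem hxΩ]
    linarith [le_max_right y 0]

theorem parallelDomain_zero (hΩ : IsOpen Ω) (hne' : Ω ≠ univ) :
    parallelDomain Ω 0 = Ω := by
  ext x
  constructor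
  · intro hx
    by_contra hc
    have : Metric.infDist x Ω - Metric.infDist x Ωᶜ < 0 := hx
    rw [Metric.infDist_zero_of_mem (show x ∈ Ωᶜ from hc), sub_zero] at this
    exact absurd this (not_lt.2 Metric.infDist_nonneg)
  · intro hx
    change Metric.infDist x Ω - Metric.infDist x Ωᶜ < 0
    rw [Metric.infDist_zero_of_mem hx, zero_sub, neg_lt_zero]
    exact (hΩ.isClosed_compl.notMem_iff_infDist_pos (nonempty_compl.2 hne')).1 (by simpa using hx)

theorem isLocalDefiningFunction_parallelDomain {δ : ℝ}
    (hd : ∀ x, |signedInfDist Ω x| < δ →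
      ContDiffAt ℝ ∞ (signedInfDist Ω) x ∧ ‖∇ (signedInfDist Ω) x‖ = 1)
    {x : EuclideanSpace ℝ (Fin n)} (hx : |signedInfDist Ω x| < δ) (y : ℝ) :
    IsLocalDefiningFunction (parallelDomain Ω y) x (fun z => signedInfDist Ω z - y) := by
  refine ⟨{z | |signedInfDist Ω z| < δ}, isOpen_lt continuous_signedInfDist.abs continuous_const,
    hx, fun z hz => ((hd z hz).1.sub contDiffAt_const).contDiffWithinAt, fun z hz => ?_,
    fun z _ => by rw [sub_neg]; rfl⟩
  have : ∇ (fun z => signedInfDist Ω z - y) z = ∇ (signedInfDist Ω) z := by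
    rw [gradient, gradient, fderiv_sub_const]
  rw [this, ← norm_ne_zero_iff, (hd z hz).2]
  exact one_ne_zero

/-- A level set could be larger than the boundary; the nonzero gradient excludes this, since moving
against it enters Ω_y. -/
theorem frontier_parallelDomain {δ : ℝ}
    (hd : ∀ x, |signedInfDist Ω x| < δ →
      ContDiffAt ℝ ∞ (signedInfDist Ω) x ∧ ‖∇ (signedInfDist Ω) x‖ = 1)
    {y : ℝ} (hy : |y| < δ) : frontier (parallelDomain Ω y) = {x | signedInfDist Ω x = y} := by
  refine Subset.antisymm (frontier_lt_subset_eq continuous_signedInfDist continuous_const)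
    fun x hx => ?_
  rw [mem_ofPred_eq] at hx
  rw [(isOpen_parallelDomain y).frontier_eq]
  refine ⟨?_, fun h => absurd h (by rw [parallelDomain, mem_ofPred_eq, hx]; exact lt_irrefl y)⟩
  have hdef := isLocalDefiningFunction_parallelDomain hd (by rwa [hx]) y
  have hg := hdef.hasGradientAt
  have hneg := hg.eventually_neg (v := -∇ (fun z => signedInfDist Ω z - y) x) (by simp [hx]) (by
    rw [inner_neg_right, neg_lt_zero]
    exact real_inner_self_pos.2 hdef.gradient_ne_zero)
  set v := -∇ (fun z => signedInfDist Ω z - y) x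
  have ht : Tendsto (fun s : ℝ => x + s • v) (𝓝[>] 0) (𝓝 x) := by
    have : Tendsto (fun s : ℝ => x + s • v) (𝓝 0) (𝓝 (x + (0 : ℝ) • v)) :=
      Continuous.tendsto (by fun_prop) _
    simp only [zero_smul, add_zero] at this
    exact this.mono_left nhdsWithin_le_nhds
  refine mem_closure_of_tendsto ht ?_
  filter_upwards [hneg] with s hs
  exact sub_neg.1 hs

/-- Since d - y defines Ω_y and has unit gradient, the single field ∇d is the normal of all leaves
at once. -/
theorem outwardUnitNormal_parallelDomain {δ : ℝ}
    (hd : ∀ x, |signedInfDist Ω x| < δ →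
      ContDiffAt ℝ ∞ (signedInfDist Ω) x ∧ ‖∇ (signedInfDist Ω) x‖ = 1)
    {x : EuclideanSpace ℝ (Fin n)} (hx : |signedInfDist Ω x| < δ) :
    outwardUnitNormal (parallelDomain Ω (signedInfDist Ω x)) x = ∇ (signedInfDist Ω) x := by
  have hmem : x ∈ frontier (parallelDomain Ω (signedInfDist Ω x)) := by
    rw [frontier_parallelDomain hd hx]; rfl
  rw [(isLocalDefiningFunction_parallelDomain hd hx _).outwardUnitNormal_eq
    (isOpen_parallelDomain _) hmem]
  have : ∇ (fun z => signedInfDist Ω z - signedInfDist Ω x) x = ∇ (signedInfDist Ω) x := by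
    rw [gradient, gradient, fderiv_sub_const]
  rw [this, (hd x hx).2, inv_one, one_smul]

/-- The surface measures of the parallel surfaces form a finite kernel that disintegrates Lebesgue
measure on the tube. -/
theorem exists_surface_kernel {δ : ℝ}
    (hd : ∀ x, |signedInfDist Ω x| < δ →
      ContDiffAt ℝ ∞ (signedInfDist Ω) x ∧ ‖∇ (signedInfDist Ω) x‖ = 1)
    {C : ℝ≥0} (hC : ∀ y, |y| < δ →
        Measure.euclideanHausdorffMeasure (n - 1) {x | signedInfDist Ω x = y} ≤ C) :
    ∃ κ : Kernel ℝ (EuclideanSpace ℝ (Fin n)), IsFiniteKernel κ ∧ (∀ y, κ y univ ≤ C) ∧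
      (∀ y, |y| < δ → κ y = surfaceMeasure (parallelDomain Ω y)) ∧
      (∀ y, ∀ᵐ x ∂κ y, signedInfDist Ω x = y) ∧
      κ ∘ₘ volume = volume.restrict {x | |signedInfDist Ω x| < δ} := by
  set T : Set (EuclideanSpace ℝ (Fin n)) := {x | |signedInfDist Ω x| < δ} with hT
  have hTm : MeasurableSet T :=
    (isOpen_lt continuous_signedInfDist.abs continuous_const).measurableSet
  have hSm : ∀ y, MeasurableSet {x | signedInfDist Ω x = y} := fun y =>
    (isClosed_eq (continuous_signedInfDist (Ω := Ω)) continuous_const).measurableSet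
  have hco : ∀ A, MeasurableSet A → _ := fun A hA =>
    coarea_unit_gradient (continuous_signedInfDist (Ω := Ω)) (U := T) (A := A ∩ T)
      (fun x hx => ⟨∇ (signedInfDist Ω) x, (hd x hx).2,
        ContDiffAt.hasStrictFDerivAt_innerSL_gradient (hd x hx).1⟩)
      inter_subset_right (hA.inter hTm)
  rw [finrank_euclideanSpace_fin] at hco
  -- Intersecting with the tube makes the measure vanish for |y| ≥ δ, where no area bound is known,
  -- so the kernel is finite with bound C.
  set μ : ℝ → Measure (EuclideanSpace ℝ (Fin n)) := fun y =>
    (Measure.euclideanHausdorffMeasure (n - 1)).restrict (T ∩ {x | signedInfDist Ω x = y}) with hμ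
  have hμA : ∀ y A, MeasurableSet A → μ y A = Measure.euclideanHausdorffMeasure (n - 1)
      (A ∩ T ∩ {x | signedInfDist Ω x = y}) := by
    intro y A hA
    rw [hμ, Measure.restrict_apply hA, inter_assoc]
  have hμm : Measurable μ := by
    refine Measure.measurable_of_measurable_coe _ fun A hA => ?_
    simp_rw [hμA _ A hA]
    exact (hco A hA).1
  have hempty : ∀ y, ¬ |y| < δ → T ∩ {x | signedInfDist Ω x = y} = ∅ := by
    intro y hy
    rw [eq_empty_iff_forall_notMem]
    rintro x ⟨hx1, hx2⟩
    rw [mem_ofPred_eq] at hx2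
    rw [hT, mem_ofPred_eq, hx2] at hx1
    exact hy hx1
  have huniv : ∀ y, μ y univ ≤ C := by
    intro y
    rw [hμA y univ MeasurableSet.univ, univ_inter]
    by_cases hy : |y| < δ
    · exact (measure_mono inter_subset_right).trans (hC y hy)
    · rw [hempty y hy, measure_empty]; exact zero_le
  refine ⟨⟨μ, hμm⟩, ⟨C, ENNReal.coe_lt_top, huniv⟩, huniv, fun y hy => ?_, fun y => ?_, ?_⟩
  · change (Measure.euclideanHausdorffMeasure (n - 1)).restrict _ = _
    rw [surfaceMeasure, frontier_parallelDomain hd hy, inter_eq_right.2]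
    intro x hx
    rw [mem_ofPred_eq] at hx
    rwa [hT, mem_ofPred_eq, hx]
  · exact (ae_restrict_mem (hTm.inter (hSm y))).mono fun x hx => hx.2
  · refine Measure.ext fun A hA => ?_
    rw [Measure.bind_apply hA (Kernel.aemeasurable _), Measure.restrict_apply hA, ← (hco A hA).2]
    exact lintegral_congr fun y => hμA y A hA

end Foliation

/-! ### The du Bois-Reymond lemma in time -/

section DuBoisReymond

/-- The primitive vanishing at +∞ serves twice: as a test function in time and as the profile ψ of
the cutoff ψ(d(x)). -/
theorem hasDerivAt_integral_Ioi {g : ℝ → ℝ} (hg : Continuous g) (hgi : Integrable g) (s : ℝ) :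
    HasDerivAt (fun s => ∫ y in Ioi s, g y) (-g s) s := by
  have h : (fun s => ∫ y in Ioi s, g y) = fun s => (∫ y in Ioi 0, g y) - ∫ y in (0 : ℝ)..s, g y := by
    funext s
    rw [← intervalIntegral.integral_interval_add_Ioi (a := 0) (b := s) hgi.integrableOn
      hgi.integrableOn]
    ring
  rw [h]
  exact (intervalIntegral.integral_hasDerivAt_right (hg.intervalIntegrable _ _)
    (hg.stronglyMeasurableAtFilter _ _) hg.continuousAt).const_sub _

theorem contDiff_integral_Ioi {g : ℝ → ℝ} (hg : ContDiff ℝ ∞ g) (hgi : Integrable g) :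
    ContDiff ℝ ∞ (fun s => ∫ y in Ioi s, g y) := by
  rw [contDiff_infty_iff_deriv]
  have h := hasDerivAt_integral_Ioi hg.continuous hgi
  refine ⟨fun s => (h s).differentiableAt, ?_⟩
  rw [show deriv (fun s => ∫ y in Ioi s, g y) = fun s => - g s from funext fun s => (h s).deriv]
  exact hg.neg

theorem exists_tsupport_subset_Icc {g : ℝ → ℝ} {a b : ℝ} (hab : a < b) (hg : HasCompactSupport g)
    (hgs : tsupport g ⊆ Ioo a b) : ∃ α β : ℝ, a < α ∧ α ≤ β ∧ β < b ∧ tsupport g ⊆ Icc α β := by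
  rcases (tsupport g).eq_empty_or_nonempty with h | h
  · refine ⟨(a + b) / 2, (a + b) / 2, by linarith, le_rfl, by linarith, ?_⟩
    rw [h]; exact empty_subset _
  · obtain ⟨α, hα⟩ := hg.exists_isLeast h
    obtain ⟨β, hβ⟩ := hg.exists_isGreatest h
    exact ⟨α, β, (hgs hα.1).1, hα.2 hβ.1, (hgs hβ.1).2, fun x hx => ⟨hα.2 hx, hβ.2 hx⟩⟩

theorem integral_Ioi_eq_zero_of_le {g : ℝ → ℝ} {α β s : ℝ} (hg : tsupport g ⊆ Icc α β)
    (hs : β ≤ s) : ∫ y in Ioi s, g y = 0 :=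
  setIntegral_eq_zero_of_forall_eq_zero fun _ hy => image_eq_zero_of_notMem_tsupport fun h =>
    absurd (hg h).2 (not_le.2 (hs.trans_lt hy))

theorem integral_Ioi_eq_integral_of_lt {g : ℝ → ℝ} {α β s : ℝ} (hg : tsupport g ⊆ Icc α β)
    (hs : s < α) : ∫ y in Ioi s, g y = ∫ y, g y :=
  setIntegral_eq_integral_of_forall_compl_eq_zero fun _ hy =>
    image_eq_zero_of_notMem_tsupport fun h => hy (hs.trans_le (hg h).1)

/-- A continuous function whose weak derivative on `(a, b)` is the integrable function `-Q`
satisfies the fundamental theorem of calculus. -/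
theorem sub_eq_neg_integral_of_weak_deriv {a b : ℝ} (hab : a < b) {M Q : ℝ → ℝ}
    (hM : ContinuousOn M (Icc a b)) (hQ : IntervalIntegrable Q volume a b)
    (h : ∀ χ : ℝ → ℝ, ContDiff ℝ ∞ χ → HasCompactSupport χ → tsupport χ ⊆ Ioo a b →
      ∫ t in a..b, (deriv χ t * M t - χ t * Q t) = 0) :
    M b - M a = - ∫ t in a..b, Q t := by
  set R : ℝ → ℝ := fun t => ∫ s in a..t, Q s with hR
  have hRac : AbsolutelyContinuousOnInterval R a b :=
    hQ.absolutelyContinuousOnInterval_intervalIntegral (by simp)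
  have hRc : ContinuousOn R (Icc a b) := by
    have := hRac.continuousOn; rwa [uIcc_of_le hab.le] at this
  set P : ℝ → ℝ := fun t => M t + R t with hP
  have hPc : ContinuousOn P (Icc a b) := hM.add hRc
  have hPi : IntegrableOn P (Icc a b) := hPc.integrableOn_Icc
  have htest : ∀ χ : ℝ → ℝ, ContDiff ℝ ∞ χ → HasCompactSupport χ → tsupport χ ⊆ Ioo a b →
      ∫ t in a..b, deriv χ t * P t = 0 := by
    intro χ hχ hχc hχs
    have hχ' : Continuous (deriv χ) := hχ.continuous_deriv (by simp)
    have hχac : AbsolutelyContinuousOnInterval χ a b :=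
      (hχ.of_le (by simp) : ContDiff ℝ 1 χ).contDiffOn.absolutelyContinuousOnInterval
    have hparts := hRac.integral_mul_deriv_eq_deriv_mul hχac
    have hχa : χ a = 0 := image_eq_zero_of_notMem_tsupport fun hc => lt_irrefl _ (hχs hc).1
    have hχb : χ b = 0 := image_eq_zero_of_notMem_tsupport fun hc => lt_irrefl _ (hχs hc).2
    have hQR : ∫ t in a..b, deriv R t * χ t = ∫ t in a..b, χ t * Q t := by
      refine intervalIntegral.integral_congr_ae ?_
      filter_upwards [hQ.ae_hasDerivAt_integral] with t ht htm
      rw [(ht (uIoc_subset_uIcc htm) a (by simp)).deriv, mul_comm]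
    rw [hχa, hχb, hQR] at hparts
    have i1 : IntervalIntegrable (fun t => deriv χ t * M t) volume a b :=
      (hχ'.continuousOn.mul (by rwa [uIcc_of_le hab.le])).intervalIntegrable
    have i2 : IntervalIntegrable (fun t => R t * deriv χ t) volume a b :=
      (ContinuousOn.mul (by rwa [uIcc_of_le hab.le]) hχ'.continuousOn).intervalIntegrable
    have i3 : IntervalIntegrable (fun t => χ t * Q t) volume a b :=
      hQ.continuousOn_mul hχ.continuous.continuousOn
    have h1 := h χ hχ hχc hχs
    rw [intervalIntegral.integral_sub i1 i3] at h1
    calc ∫ t in a..b, deriv χ t * P t = ∫ t in a..b, (deriv χ t * M t + R t * deriv χ t) := by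
          congr 1; funext t; rw [hP]; ring
      _ = _ := by
          rw [intervalIntegral.integral_add i1 i2, hparts]; linarith
  -- a bump of mass one
  let B : ContDiffBump ((a + b) / 2) := ⟨(b - a) / 8, (b - a) / 4, by linarith, by linarith⟩
  set η : ℝ → ℝ := B.normed volume with hη
  have hηs : tsupport η ⊆ Ioo a b := by
    rw [hη, B.tsupport_normed_eq, Real.closedBall_eq_Icc]
    intro x hx
    have h1 : (a + b) / 2 - (b - a) / 4 ≤ x := hx.1
    have h2 : x ≤ (a + b) / 2 + (b - a) / 4 := hx.2
    exact ⟨by linarith, by linarith⟩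
  have hηd : ContDiff ℝ ∞ η := B.contDiff_normed
  have hηc : HasCompactSupport η := B.hasCompactSupport_normed
  have hηi : ∫ t, η t = 1 := B.integral_normed
  have hIoo : ∀ g : ℝ → ℝ, tsupport g ⊆ Ioo a b → ∀ c : ℝ,
      ∫ t, g t * (P t - c) = ∫ t in a..b, g t * (P t - c) := by
    intro g hg c
    rw [intervalIntegral.integral_of_le hab.le]
    refine (setIntegral_eq_integral_of_forall_compl_eq_zero fun t ht => ?_).symm
    rw [image_eq_zero_of_notMem_tsupport fun hc => ht (Ioo_subset_Ioc_self (hg hc)), zero_mul]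
  set c : ℝ := ∫ t in a..b, η t * P t with hc
  have hzero : ∀ g : ℝ → ℝ, ContDiff ℝ ∞ g → HasCompactSupport g → tsupport g ⊆ Ioo a b →
      ∫ t, g t • (P t - c) = 0 := by
    intro g hg hgc hgs
    set m : ℝ := ∫ t, g t with hm
    -- Subtracting m η makes the mean zero, which is exactly what gives k a primitive with compact
    -- support in (a, b).
    set k : ℝ → ℝ := fun t => g t - m * η t with hk
    have hgi : Integrable g := hg.continuous.integrable_of_hasCompactSupport hgc
    have hηint : Integrable η := hηd.continuous.integrable_of_hasCompactSupport hηc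
    have hkd : ContDiff ℝ ∞ k := hg.sub (contDiff_const.mul hηd)
    have hkc : HasCompactSupport k := hgc.sub (hηc.mul_left (f := fun _ => m))
    have hks : tsupport k ⊆ Ioo a b := by
      refine (tsupport_sub g _).trans (union_subset hgs ?_)
      exact (tsupport_mul_subset_right (f := fun _ => m) (g := η)).trans hηs
    have hki : Integrable k := hgi.sub (hηint.const_mul m)
    have hk0 : ∫ t, k t = 0 := by
      rw [hk, integral_sub hgi (hηint.const_mul m), integral_const_mul, hηi, mul_one, sub_self]
    obtain ⟨α, β, hα, hαβ, hβ, hkαβ⟩ := exists_tsupport_subset_Icc hab hkc hks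
    set χ : ℝ → ℝ := fun s => ∫ y in Ioi s, k y with hχ
    have hχsupp : tsupport χ ⊆ Icc α β := by
      refine closure_minimal (fun s hs => ?_) isClosed_Icc
      by_contra hsn
      rw [mem_Icc, not_and_or, not_le, not_le] at hsn
      rcases hsn with hsn | hsn
      · exact hs ((integral_Ioi_eq_integral_of_lt hkαβ hsn).trans hk0)
      · exact hs (integral_Ioi_eq_zero_of_le hkαβ hsn.le)
    have := htest χ (contDiff_integral_Ioi hkd hki)
      (HasCompactSupport.of_support_subset_isCompact isCompact_Icc
        ((subset_tsupport χ).trans hχsupp))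
      (hχsupp.trans fun t ht => ⟨hα.trans_le ht.1, ht.2.trans_lt hβ⟩)
    have hder : ∀ t, deriv χ t = - k t := fun t =>
      (hasDerivAt_integral_Ioi hkd.continuous hki t).deriv
    simp_rw [hder, neg_mul] at this
    rw [intervalIntegral.integral_neg, neg_eq_zero] at this
    have hPii : ContinuousOn P (uIcc a b) := by rwa [uIcc_of_le hab.le]
    have i1 : IntervalIntegrable (fun t => g t * P t) volume a b :=
      (hg.continuous.continuousOn.mul hPii).intervalIntegrable
    have i2 : IntervalIntegrable (fun t => m * (η t * P t)) volume a b :=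
      ((hηd.continuous.continuousOn.mul hPii).intervalIntegrable).const_mul m
    have i3 : IntervalIntegrable (fun t => g t * c) volume a b :=
      (hg.continuous.mul continuous_const).intervalIntegrable _ _
    have h1 : ∫ t in a..b, g t * P t = m * c := by
      have : ∫ t in a..b, (g t * P t - m * (η t * P t)) = 0 := by
        rw [← this]; congr 1; funext t; rw [hk]; ring
      rw [intervalIntegral.integral_sub i1 i2, intervalIntegral.integral_const_mul] at this
      linarith
    have h2 : ∫ t in a..b, g t = m := by
      rw [intervalIntegral.integral_of_le hab.le]
      exact setIntegral_eq_integral_of_forall_compl_eq_zero fun t ht =>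
        image_eq_zero_of_notMem_tsupport fun hc => ht (Ioo_subset_Ioc_self (hgs hc))
    simp_rw [smul_eq_mul]
    rw [hIoo g hgs]
    simp_rw [mul_sub]
    rw [intervalIntegral.integral_sub i1 i3, h1, intervalIntegral.integral_mul_const, h2, sub_self]
  have hloc : LocallyIntegrableOn (fun t => P t - c) (Ioo a b) :=
    ((hPi.mono_set Ioo_subset_Icc_self).sub (integrableOn_const (by simp))).locallyIntegrableOn
  have hae := isOpen_Ioo.ae_eq_zero_of_integral_contDiff_smul_eq_zero hloc hzero
  have hae' : P =ᵐ[volume.restrict (Icc a b)] fun _ => c := by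
    rw [← Measure.restrict_congr_set Ioo_ae_eq_Icc]
    rw [EventuallyEq, ae_restrict_iff' measurableSet_Ioo]
    filter_upwards [hae] with t ht hti
    exact sub_eq_zero.1 (ht hti)
  have heq := Measure.eqOn_Icc_of_ae_eq volume hab.ne hae' hPc continuousOn_const
  have ha := heq (left_mem_Icc.2 hab.le)
  have hb := heq (right_mem_Icc.2 hab.le)
  simp only [hP, hR, intervalIntegral.integral_same] at ha hb
  linarith

end DuBoisReymond

/-! ### Disintegration of integrals along a kernel -/

section Disintegration

open ProbabilityTheory
open scoped ENNReal

variable {α β γ F : Type*} [MeasurableSpace α] [MeasurableSpace β] [MeasurableSpace γ]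
  [NormedAddCommGroup F] [NormedSpace ℝ F] {μ : Measure α} {κ : Kernel α β}

theorem MeasureTheory.Integrable.integral_comp_measure {f : β → F} (hf : Integrable f (κ ∘ₘ μ)) :
    Integrable (fun a => ∫ b, f b ∂κ a) μ ∧ ∫ b, f b ∂(κ ∘ₘ μ) = ∫ a, ∫ b, f b ∂κ a ∂μ := by
  rw [Measure.comp_eq_comp_const_apply] at hf ⊢
  have h1 := hf.integral_comp
  rw [Kernel.const_apply] at h1
  exact ⟨h1, by rw [Kernel.integral_comp hf, Kernel.const_apply]⟩

/-- A property that holds almost everywhere for `(κ ∘ₘ μ) × τ` holds, for almost every `a`, almost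
everywhere for `κ a × τ`. -/
theorem ae_ae_prod_of_ae_comp_prod [IsSFiniteKernel κ] {τ : Measure γ} [SFinite τ]
    {p : β × γ → Prop} (h : ∀ᵐ z ∂((κ ∘ₘ μ).prod τ), p z) :
    ∀ᵐ a ∂μ, ∀ᵐ z ∂((κ a).prod τ), p z := by
  obtain ⟨S, hS, hSm, hS0⟩ := exists_measurable_superset_of_null (ae_iff.1 h)
  have h1 : ∀ᵐ z ∂((κ ∘ₘ μ).prod τ), z ∉ S := measure_eq_zero_iff_ae_notMem.1 hS0
  have h2 : ∀ᵐ b ∂(κ ∘ₘ μ), τ (Prod.mk b ⁻¹' S) = 0 := by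
    filter_upwards [Measure.ae_ae_of_ae_prod h1] with b hb
    exact measure_eq_zero_iff_ae_notMem.2 hb
  filter_upwards [Measure.ae_ae_of_ae_comp h2] with a ha
  have h3 : (κ a).prod τ S = 0 := (Measure.measure_prod_null hSm).2 ha
  filter_upwards [measure_eq_zero_iff_ae_notMem.1 h3] with z hz
  by_contra hp
  exact hz (hS hp)

/-- Disintegration of an integral along the level sets of `d`, with an additional parameter. -/
theorem integral_comp_level_mul {μ : Measure ℝ} {κ : Kernel ℝ β}
    [IsFiniteKernel κ] {τ : Measure γ} [IsFiniteMeasure τ] [SFinite (κ ∘ₘ μ)]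
    {d : β → ℝ} (hd : Measurable d) (hκ : ∀ y, ∀ᵐ b ∂κ y, d b = y) {f : β × γ → ℝ}
    (hf : Integrable f ((κ ∘ₘ μ).prod τ)) (hfy : ∀ᵐ y ∂μ, Integrable f ((κ y).prod τ))
    {g : ℝ → ℝ} (hg : Measurable g) {K : ℝ} (hgK : ∀ y, |g y| ≤ K) :
    Integrable (fun y => ∫ t, ∫ b, f (b, t) ∂κ y ∂τ) μ ∧
    ∫ t, ∫ b, g (d b) * f (b, t) ∂(κ ∘ₘ μ) ∂τ = ∫ y, g y * ∫ t, ∫ b, f (b, t) ∂κ y ∂τ ∂μ := by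
  have hΦ : Integrable (fun b => ∫ t, f (b, t) ∂τ) (κ ∘ₘ μ) := hf.integral_prod_left
  have hswap : ∀ᵐ y ∂μ, ∫ b, ∫ t, f (b, t) ∂τ ∂κ y = ∫ t, ∫ b, f (b, t) ∂κ y ∂τ := by
    filter_upwards [hfy] with y hy
    exact integral_integral_swap (f := fun b t => f (b, t)) hy
  have hgΦ : Integrable (fun b => g (d b) * ∫ t, f (b, t) ∂τ) (κ ∘ₘ μ) :=
    hΦ.bdd_mul (hg.comp hd).aestronglyMeasurable (Eventually.of_forall fun b => hgK (d b))
  have hgf : Integrable (fun z : β × γ => g (d z.1) * f z) ((κ ∘ₘ μ).prod τ) :=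
    hf.bdd_mul (hg.comp (hd.comp measurable_fst)).aestronglyMeasurable
      (Eventually.of_forall fun z => hgK (d z.1))
  refine ⟨hΦ.integral_comp_measure.1.congr hswap, ?_⟩
  rw [← integral_integral_swap (f := fun b t => g (d b) * f (b, t)) hgf]
  simp_rw [integral_const_mul]
  rw [hgΦ.integral_comp_measure.2]
  refine integral_congr_ae ?_
  filter_upwards [hswap] with y hy
  rw [← hy, ← integral_const_mul]
  refine integral_congr_ae ?_
  -- The measure κ y lives on the level set d = y, so g(d b) is the constant g y.
  filter_upwards [hκ y] with b hb
  rw [hb]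

end Disintegration

/-! ### Shells between parallel surfaces and cutoff functions -/

section Shell

open ProbabilityTheory
open scoped ENNReal

variable {n : ℕ} {Ω : Set (EuclideanSpace ℝ (Fin n))}

theorem parallelDomain_mono {y y' : ℝ} (h : y' ≤ y) : parallelDomain Ω y' ⊆ parallelDomain Ω y :=
  fun _ hx => lt_of_lt_of_le hx h

theorem measurable_signedInfDist : Measurable (signedInfDist Ω) :=
  continuous_signedInfDist.measurable

/-- The volume of the shell between two parallel surfaces is at most linear in its width. -/
theorem volume_parallelDomain_diff_le {δ : ℝ} {C : ℝ≥0}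
    {κ : Kernel ℝ (EuclideanSpace ℝ (Fin n))} (hκC : ∀ y, κ y univ ≤ C)
    (hκ : ∀ y, ∀ᵐ x ∂κ y, signedInfDist Ω x = y)
    (hvol : κ ∘ₘ volume = volume.restrict {x | |signedInfDist Ω x| < δ})
    {y y' : ℝ} (hy' : -δ < y') (hy : y < δ) :
    volume (parallelDomain Ω y \ parallelDomain Ω y') ≤ C * ENNReal.ofReal (y - y') := by
  set S := parallelDomain Ω y \ parallelDomain Ω y' with hS
  have hSm : MeasurableSet S :=
    (isOpen_parallelDomain y).measurableSet.diff (isOpen_parallelDomain y').measurableSet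
  have hsub : S ⊆ {x | |signedInfDist Ω x| < δ} := by
    rintro x ⟨h1, h2⟩
    have h1' : signedInfDist Ω x < y := h1
    have h2' : y' ≤ signedInfDist Ω x := not_lt.1 h2
    exact show |signedInfDist Ω x| < δ from abs_lt.2 ⟨by linarith, by linarith⟩
  have h1 : volume S = ∫⁻ s, κ s S := by
    rw [← Measure.restrict_eq_self volume hsub, ← hvol,
      Measure.bind_apply hSm (Kernel.aemeasurable _)]
  rw [h1]
  -- Leaves with s outside [y', y) miss the shell; the others have area at most C.
  have h2 : ∀ s, κ s S ≤ (Ico y' y).indicator (fun _ => (C : ℝ≥0∞)) s := by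
    intro s
    by_cases hs : s ∈ Ico y' y
    · rw [indicator_of_mem hs]
      exact (measure_mono (subset_univ _)).trans (hκC s)
    · rw [indicator_of_notMem hs, nonpos_iff_eq_zero, measure_eq_zero_iff_ae_notMem]
      filter_upwards [hκ s] with x hx hxS
      have h1' : signedInfDist Ω x < y := hxS.1
      have h2' : y' ≤ signedInfDist Ω x := not_lt.1 hxS.2
      rw [hx] at h1' h2'
      exact hs ⟨h2', h1'⟩
  refine (lintegral_mono h2).trans_eq ?_
  rw [lintegral_indicator_const measurableSet_Ico, Real.volume_Ico]

/-- A function of the signed distance that is constant away from the tube is smooth. -/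
theorem contDiff_comp_signedInfDist {δ : ℝ}
    (hd : ∀ x, |signedInfDist Ω x| < δ →
      ContDiffAt ℝ ∞ (signedInfDist Ω) x ∧ ‖∇ (signedInfDist Ω) x‖ = 1)
    {g : ℝ → ℝ} (hg : ContDiff ℝ ∞ g) (hgc : HasCompactSupport g) {α β : ℝ} (hα : -δ < α)
    (hβ : β < δ) (hgs : tsupport g ⊆ Icc α β) :
    ContDiff ℝ ∞ (fun x => ∫ y in Ioi (signedInfDist Ω x), g y) ∧
    ∀ x, ∇ (fun x => ∫ y in Ioi (signedInfDist Ω x), g y) x =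
      -(g (signedInfDist Ω x) • ∇ (signedInfDist Ω) x) := by
  have hgi : Integrable g := hg.continuous.integrable_of_hasCompactSupport hgc
  have hψ := contDiff_integral_Ioi hg hgi
  have hloc : ∀ x, ¬ |signedInfDist Ω x| < δ → g (signedInfDist Ω x) = 0 ∧
      ∃ c, (fun x => ∫ y in Ioi (signedInfDist Ω x), g y) =ᶠ[𝓝 x] fun _ => c := by
    intro x hx
    rw [abs_lt, not_and_or, not_lt, not_lt] at hx
    refine ⟨image_eq_zero_of_notMem_tsupport fun h => ?_, ?_⟩
    · have := hgs h
      rcases hx with hx | hx <;> linarith [this.1, this.2]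
    · rcases hx with hx | hx
      · refine ⟨∫ y, g y, ?_⟩
        filter_upwards [(continuous_signedInfDist (Ω := Ω)).continuousAt.eventually
          (gt_mem_nhds (hx.trans_lt hα))] with z hz
        exact integral_Ioi_eq_integral_of_lt hgs hz
      · refine ⟨0, ?_⟩
        filter_upwards [(continuous_signedInfDist (Ω := Ω)).continuousAt.eventually
          (lt_mem_nhds (hβ.trans_le hx))] with z hz
        exact integral_Ioi_eq_zero_of_le hgs hz.le
  constructor
  · rw [contDiff_iff_contDiffAt]
    intro x
    by_cases hx : |signedInfDist Ω x| < δ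
    · exact hψ.contDiffAt.comp x (hd x hx).1
    · obtain ⟨-, c, hc⟩ := hloc x hx
      exact contDiffAt_const.congr_of_eventuallyEq hc
  · intro x
    by_cases hx : |signedInfDist Ω x| < δ
    · refine HasGradientAt.gradient ?_
      rw [hasGradientAt_iff_hasFDerivAt, map_neg, map_smul, toDual_gradient, ← neg_smul]
      exact (hasDerivAt_integral_Ioi hg.continuous hgi _).comp_hasFDerivAt x
        ((hd x hx).1.differentiableAt (by simp)).hasFDerivAt
    · obtain ⟨h0, c, hc⟩ := hloc x hx
      rw [h0, zero_smul, neg_zero, hc.gradient_eq, gradient_fun_const]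

end Shell

/-! ### From almost every time to every time -/

section ContinuousBounds

/-- F and min(F, c) are continuous and agree almost everywhere, hence everywhere on the interval,
including the endpoints t₁ and t₂ that matter later. -/
theorem le_of_ae_le_of_continuousOn {a b : ℝ} (hab : a < b) {F : ℝ → ℝ} {c : ℝ}
    (hF : ContinuousOn F (Icc a b)) (h : ∀ᵐ t ∂(volume.restrict (Icc a b)), F t ≤ c) :
    ∀ t ∈ Icc a b, F t ≤ c := by
  have h1 : F =ᵐ[volume.restrict (Icc a b)] fun t => min (F t) c := by
    filter_upwards [h] with t ht
    rw [min_eq_left ht]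
  intro t ht
  have := Measure.eqOn_Icc_of_ae_eq volume hab.ne h1 hF (hF.inf continuousOn_const) ht
  rw [this]
  exact min_le_right _ _

end ContinuousBounds

/-! ### Layer-cake formula, test functions and integrability of the normal flux -/

section WeakForm

open ProbabilityTheory
open scoped ENNReal

variable {n D : ℕ} {Ω : Set (EuclideanSpace ℝ (Fin n))}

/-- Layer-cake formula: the mass weighted by a function of the signed distance is a superposition
of masses of parallel domains. -/
theorem integral_mul_integral_Ioi_signedInfDist {v : EuclideanSpace ℝ (Fin n) → ℝ} {δ : ℝ}
    (hv : IntegrableOn v (parallelDomain Ω δ)) {g : ℝ → ℝ} (hg : Continuous g)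
    (hgc : HasCompactSupport g) {α β : ℝ} (hβ : β < δ) (hgs : tsupport g ⊆ Icc α β) :
    Integrable (fun y => g y * ∫ x in parallelDomain Ω y, v x) ∧
    IntegrableOn (fun x => v x * ∫ y in Ioi (signedInfDist Ω x), g y) (parallelDomain Ω δ) ∧
    ∫ x in parallelDomain Ω δ, v x * ∫ y in Ioi (signedInfDist Ω x), g y =
      ∫ y, g y * ∫ x in parallelDomain Ω y, v x := by
  have hgi : Integrable g := hg.integrable_of_hasCompactSupport hgc
  set S : Set (EuclideanSpace ℝ (Fin n) × ℝ) := {z | signedInfDist Ω z.1 < z.2} with hS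
  have hSm : MeasurableSet S :=
    measurableSet_lt (measurable_signedInfDist.comp measurable_fst) measurable_snd
  set k : EuclideanSpace ℝ (Fin n) × ℝ → ℝ := S.indicator fun z => v z.1 * g z.2 with hk
  have hki : Integrable k ((volume.restrict (parallelDomain Ω δ)).prod volume) :=
    (Integrable.mul_prod hv hgi).indicator hSm
  have h1 : ∀ x, ∫ y, k (x, y) = v x * ∫ y in Ioi (signedInfDist Ω x), g y := by
    intro x
    rw [← integral_const_mul, ← integral_indicator measurableSet_Ioi]
    rfl
  have h2 : ∀ y, ∫ x in parallelDomain Ω δ, k (x, y) = g y * ∫ x in parallelDomain Ω y, v x := by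
    intro y
    have : (fun x => k (x, y)) = (parallelDomain Ω y).indicator fun x => v x * g y := rfl
    rw [this, setIntegral_indicator (isOpen_parallelDomain y).measurableSet, integral_mul_const,
      mul_comm]
    -- Truncation to Ω_δ is harmless: either Ω_y ⊆ Ω_δ, or y is beyond the support of g.
    by_cases hy : y ≤ β
    · rw [inter_eq_right.2 (parallelDomain_mono (hy.trans hβ.le))]
    · have : g y = 0 := image_eq_zero_of_notMem_tsupport fun h => hy (hgs h).2
      rw [this, zero_mul, zero_mul]
  refine ⟨?_, ?_, ?_⟩
  · simp_rw [← h2]; exact hki.integral_prod_right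
  · simp_rw [← h1]; exact hki.integral_prod_left
  · simp_rw [← h1, ← h2]
    exact integral_integral_swap (f := fun x y => k (x, y)) hki

/-- The weak formulation tested against `χ(t) ψ(d(x)) e_i`. -/
theorem IsWeakSolution.integral_test_eq_zero
    {f : EuclideanSpace ℝ (Fin D) → Fin D → EuclideanSpace ℝ (Fin n)}
    {u : EuclideanSpace ℝ (Fin n) → ℝ → EuclideanSpace ℝ (Fin D)} (hu : IsWeakSolution f u)
    {B : Set (EuclideanSpace ℝ (Fin n))} (hBo : IsOpen B) (hBb : Bornology.IsBounded B)
    {t₁ t₂ : ℝ} (ht₁ : 0 ≤ t₁) (ht : t₁ < t₂) (i : Fin D)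
    {w : EuclideanSpace ℝ (Fin n) → ℝ} (hw : ContDiff ℝ ∞ w) {A : Set (EuclideanSpace ℝ (Fin n))}
    (hA : IsClosed A) (hAB : A ⊆ B) (hwA : Function.support w ⊆ A)
    {χ : ℝ → ℝ} (hχ : ContDiff ℝ ∞ χ) (hχc : HasCompactSupport χ)
    (hχs : tsupport χ ⊆ Ioo t₁ t₂) :
    ∫ t in t₁..t₂, ∫ x in B, (u x t i * (deriv χ t * w x) +
      χ t * inner ℝ (f (u x t) i) (∇ w x)) = 0 := by
  set e : EuclideanSpace ℝ (Fin D) := EuclideanSpace.single i 1 with he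
  set φ : EuclideanSpace ℝ (Fin n) × ℝ → EuclideanSpace ℝ (Fin D) :=
    fun z => (χ z.2 * w z.1) • e with hφ
  have hφd : ContDiff ℝ ∞ φ :=
    ((hχ.comp contDiff_snd).mul (hw.comp contDiff_fst)).smul contDiff_const
  have hsub : tsupport φ ⊆ A ×ˢ tsupport χ := by
    refine closure_minimal (fun z hz => ?_) (hA.prod (isClosed_tsupport χ))
    have h1 : χ z.2 * w z.1 ≠ 0 := fun h => hz (by simp only [hφ, h, zero_smul])
    exact ⟨hwA (right_ne_zero_of_mul h1), subset_tsupport χ (left_ne_zero_of_mul h1)⟩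
  have hcpt : IsCompact (A ×ˢ tsupport χ) :=
    (Metric.isCompact_of_isClosed_isBounded hA (hBb.subset hAB)).prod hχc
  have hφc : HasCompactSupport φ := hcpt.of_isClosed_subset (isClosed_tsupport φ) hsub
  have hmain := hu B t₁ t₂ hBo hBb ht₁ ht φ hφd hφc (hsub.trans (prod_mono hAB hχs))
  have hder : ∀ (j : Fin D) x t, deriv (fun s => φ (x, s) j) t = deriv χ t * w x * e j := by
    intro j x t
    have : (fun s => φ (x, s) j) = fun s => χ s * w x * e j := rfl
    rw [this, deriv_mul_const, deriv_mul_const]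
    · exact (hχ.differentiable (by simp)) t
    · exact ((hχ.differentiable (by simp)) t).mul_const _
  have hgr : ∀ (j : Fin D) x t, ∇ (fun z => φ (z, t) j) x = (e j * χ t) • ∇ w x := by
    intro j x t
    have : (fun z => φ (z, t) j) = fun z => (e j * χ t) * w z := by
      funext z; simp only [hφ, PiLp.smul_apply, smul_eq_mul]; ring
    rw [this, gradient, fderiv_const_mul ((hw.differentiable (by simp)) x), map_smul]
    rfl
  simp_rw [hder, hgr] at hmain
  rw [Finset.sum_eq_single i] at hmain
  · rw [← hmain]
    have : e i = 1 := by simp [he]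
    simp_rw [this, mul_one, one_mul, inner_smul_right]
  · intro j _ hj
    have : e j = 0 := by simp [he, hj]
    simp [this]
  · simp

/-- The normal flux density on the tube is bounded and measurable, hence integrable, both on the
tube and on almost every parallel surface. -/
theorem integrable_normal_component {δ : ℝ}
    (hd : ∀ x, |signedInfDist Ω x| < δ →
      ContDiffAt ℝ ∞ (signedInfDist Ω) x ∧ ‖∇ (signedInfDist Ω) x‖ = 1)
    {κ : Kernel ℝ (EuclideanSpace ℝ (Fin n))} [IsFiniteKernel κ]
    (hvol : κ ∘ₘ volume = volume.restrict {x | |signedInfDist Ω x| < δ})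
    (hfin : volume {x | |signedInfDist Ω x| < δ} ≠ ⊤)
    {τ : Measure ℝ} [IsFiniteMeasure τ]
    {v : EuclideanSpace ℝ (Fin n) × ℝ → EuclideanSpace ℝ (Fin n)}
    (hv : AEStronglyMeasurable v ((volume.restrict {x | |signedInfDist Ω x| < δ}).prod τ))
    {K : ℝ} (hK : ∀ᵐ z ∂((volume.restrict {x | |signedInfDist Ω x| < δ}).prod τ), ‖v z‖ ≤ K) :
    Integrable (fun z : EuclideanSpace ℝ (Fin n) × ℝ => inner ℝ (v z) (∇ (signedInfDist Ω) z.1))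
      ((volume.restrict {x | |signedInfDist Ω x| < δ}).prod τ) ∧
    ∀ᵐ y, Integrable
      (fun z : EuclideanSpace ℝ (Fin n) × ℝ => inner ℝ (v z) (∇ (signedInfDist Ω) z.1))
      ((κ y).prod τ) := by
  set T := {x | |signedInfDist Ω x| < δ} with hT
  have hTo : IsOpen T := isOpen_lt continuous_signedInfDist.abs continuous_const
  set F : EuclideanSpace ℝ (Fin n) × ℝ → ℝ := fun z => inner ℝ (v z) (∇ (signedInfDist Ω) z.1)
    with hF
  have : IsFiniteMeasure (volume.restrict T) := ⟨by
    rw [Measure.restrict_apply_univ]; exact lt_top_iff_ne_top.2 hfin⟩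
  have hgrad : AEStronglyMeasurable (∇ (signedInfDist Ω)) (volume.restrict T) :=
    (contDiffOn_gradient hTo fun x hx => (hd x hx).1.contDiffWithinAt).continuousOn
      |>.aestronglyMeasurable hTo.measurableSet
  have hFm : AEStronglyMeasurable F ((volume.restrict T).prod τ) := hv.inner hgrad.comp_fst
  have hTae : ∀ᵐ z ∂((volume.restrict T).prod τ), z.1 ∈ T :=
    Measure.quasiMeasurePreserving_fst.ae (ae_restrict_mem hTo.measurableSet)
  have hFK : ∀ᵐ z ∂((volume.restrict T).prod τ), ‖F z‖ ≤ K := by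
    filter_upwards [hK, hTae] with z hz hzT
    refine (norm_inner_le_norm _ _).trans ?_
    rw [(hd z.1 hzT).2, mul_one]
    exact hz
  refine ⟨Integrable.of_bound hFm K hFK, ?_⟩
  -- The leaves are null sets, so measurability up to null sets does not restrict to them. A
  -- genuinely measurable representative agrees with F almost everywhere on almost every leaf.
  obtain ⟨G, hG, hFG⟩ := hFm
  have hboth := hFG.and hFK
  rw [← hvol] at hboth
  filter_upwards [ae_ae_prod_of_ae_comp_prod hboth] with y hy
  refine Integrable.of_bound ⟨G, hG, ?_⟩ K ?_
  · filter_upwards [hy] with z hz using hz.1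
  · filter_upwards [hy] with z hz using hz.2

end WeakForm

/-! ### Mass estimates and the weak balance law -/

section Balance

open ProbabilityTheory
open scoped ENNReal

variable {n D : ℕ} {Ω : Set (EuclideanSpace ℝ (Fin n))}
  {f : EuclideanSpace ℝ (Fin D) → Fin D → EuclideanSpace ℝ (Fin n)}
  {u : EuclideanSpace ℝ (Fin n) → ℝ → EuclideanSpace ℝ (Fin D)}

theorem HasContinuousMass.integrableOn_apply (hu : HasContinuousMass u)
    {B : Set (EuclideanSpace ℝ (Fin n))} (hBo : IsOpen B) (hBb : Bornology.IsBounded B) {t : ℝ}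
    (ht : 0 ≤ t) (i : Fin D) : IntegrableOn (fun x => u x t i) B :=
  (EuclideanSpace.proj (𝕜 := ℝ) i).integrable_comp ((hu B hBo hBb).1 t ht)

theorem HasContinuousMass.continuousOn_apply (hu : HasContinuousMass u)
    {B : Set (EuclideanSpace ℝ (Fin n))} (hBo : IsOpen B) (hBb : Bornology.IsBounded B)
    (i : Fin D) : ContinuousOn (fun t : ℝ => ∫ x in B, u x t i) (Ici 0) := by
  let L : EuclideanSpace ℝ (Fin D) →L[ℝ] ℝ := EuclideanSpace.proj i
  exact (L.continuous.comp_continuousOn (hu B hBo hBb).2).congr fun t ht =>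
    L.integral_comp_comm ((hu B hBo hBb).1 t ht)

theorem ae_ae_swap {X : Type*} [MeasurableSpace X] {ν : Measure X} [SFinite ν] {τ : Measure ℝ}
    [SFinite τ] {p : X × ℝ → Prop} (h : ∀ᵐ z ∂(ν.prod τ), p z) :
    ∀ᵐ t ∂τ, ∀ᵐ x ∂ν, p (x, t) :=
  Measure.ae_ae_of_ae_prod
    (p := fun w => p w.swap) (Measure.measurePreserving_swap.quasiMeasurePreserving.ae h)

/-- An essential bound for `u` in space-time bounds the mass on a set at every time at which that
mass is continuous. -/
theorem abs_mass_le {B S : Set (EuclideanSpace ℝ (Fin n))} (hSB : S ⊆ B)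
    (hSf : volume S ≠ ⊤) {t₁ t₂ K : ℝ} (ht : t₁ < t₂)
    (hK : ∀ᵐ z ∂((volume.restrict B).prod (volume.restrict (Icc t₁ t₂))), ‖u z.1 z.2‖ ≤ K)
    (i : Fin D) (hc : ContinuousOn (fun t => ∫ x in S, u x t i) (Icc t₁ t₂)) :
    ∀ t ∈ Icc t₁ t₂, |∫ x in S, u x t i| ≤ K * volume.real S := by
  refine le_of_ae_le_of_continuousOn ht hc.abs ?_
  filter_upwards [ae_ae_swap hK] with t ht
  rw [← Real.norm_eq_abs]
  refine norm_setIntegral_le_of_norm_le_const_ae (lt_top_iff_ne_top.2 hSf) ?_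
  filter_upwards [ae_restrict_of_ae_restrict_of_subset hSB ht] with x hx
  exact (PiLp.norm_apply_le _ i).trans hx

/-- The shell need not be open, so its mass is continuous only as a difference of masses of two
parallel domains; then the essential bound holds at every time. -/
theorem abs_mass_sub_le (hu : HasContinuousMass u) {δ : ℝ}
    (hB : Bornology.IsBounded (parallelDomain Ω δ)) {t₁ t₂ K : ℝ} (ht₁ : 0 ≤ t₁) (ht : t₁ < t₂)
    (hK : ∀ᵐ z ∂((volume.restrict (parallelDomain Ω δ)).prod (volume.restrict (Icc t₁ t₂))),
      ‖u z.1 z.2‖ ≤ K) (i : Fin D) {y y' : ℝ} (hyy' : y' ≤ y) (hy : y ≤ δ) :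
    ∀ t ∈ Icc t₁ t₂, |(∫ x in parallelDomain Ω y, u x t i) - ∫ x in parallelDomain Ω y', u x t i| ≤
      K * volume.real (parallelDomain Ω y \ parallelDomain Ω y') := by
  have hsub := parallelDomain_mono (Ω := Ω) hy
  have hsub' := parallelDomain_mono (Ω := Ω) hyy'
  have hI : Icc t₁ t₂ ⊆ Ici 0 := fun t h => ht₁.trans h.1
  have heq : ∀ t ∈ Icc t₁ t₂, ∫ x in parallelDomain Ω y \ parallelDomain Ω y', u x t i =
      (∫ x in parallelDomain Ω y, u x t i) - ∫ x in parallelDomain Ω y', u x t i := fun t h =>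
    setIntegral_sdiff (isOpen_parallelDomain y').measurableSet
      (hu.integrableOn_apply (isOpen_parallelDomain y) (hB.subset hsub) (hI h) i) hsub'
  have hc : ContinuousOn (fun t => ∫ x in parallelDomain Ω y \ parallelDomain Ω y', u x t i)
      (Icc t₁ t₂) :=
    (((hu.continuousOn_apply (isOpen_parallelDomain y) (hB.subset hsub) i).mono hI).sub
      ((hu.continuousOn_apply (isOpen_parallelDomain y')
        (hB.subset (hsub'.trans hsub)) i).mono hI)).congr heq
  intro t h
  rw [← heq t h]
  exact abs_mass_le (sdiff_subset.trans hsub)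
    (hB.subset (sdiff_subset.trans hsub)).measure_lt_top.ne ht hK i hc t h

/-- Weak balance law across the tube. -/
theorem integral_mul_mass_sub_eq {δ : ℝ} (hu : IsWeakSolution f u) (hum : HasContinuousMass u)
    (hB : Bornology.IsBounded (parallelDomain Ω δ)) {t₁ t₂ K : ℝ} (ht₁ : 0 ≤ t₁) (ht : t₁ < t₂)
    (hK : ∀ᵐ z ∂((volume.restrict (parallelDomain Ω δ)).prod (volume.restrict (Icc t₁ t₂))),
      ‖u z.1 z.2‖ ≤ K) (i : Fin D)
    (hd : ∀ x, |signedInfDist Ω x| < δ →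
      ContDiffAt ℝ ∞ (signedInfDist Ω) x ∧ ‖∇ (signedInfDist Ω) x‖ = 1)
    (hF : Integrable (fun z : EuclideanSpace ℝ (Fin n) × ℝ =>
        inner ℝ (f (u z.1 z.2) i) (∇ (signedInfDist Ω) z.1))
      ((volume.restrict {x | |signedInfDist Ω x| < δ}).prod (volume.restrict (Icc t₁ t₂))))
    {g : ℝ → ℝ} (hg : ContDiff ℝ ∞ g) (hgc : HasCompactSupport g) {α β : ℝ} (hα : -δ < α)
    (hβ : β < δ) (hgs : tsupport g ⊆ Icc α β) :
    (∫ y, g y * ∫ x in parallelDomain Ω y, u x t₂ i) -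
      (∫ y, g y * ∫ x in parallelDomain Ω y, u x t₁ i) =
    - ∫ t in Icc t₁ t₂, ∫ x in {x | |signedInfDist Ω x| < δ},
        g (signedInfDist Ω x) * inner ℝ (f (u x t) i) (∇ (signedInfDist Ω) x) := by
  set d := signedInfDist Ω with hd_def
  set T := {x | |d x| < δ} with hT
  have hTm : MeasurableSet T := (isOpen_lt continuous_signedInfDist.abs
    continuous_const).measurableSet
  have hTB : T ⊆ parallelDomain Ω δ := fun x hx => (abs_lt.1 (show |d x| < δ from hx)).2
  set w : EuclideanSpace ℝ (Fin n) → ℝ := fun x => ∫ y in Ioi (d x), g y with hw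
  obtain ⟨hwd, hwg⟩ := contDiff_comp_signedInfDist hd hg hgc hα hβ hgs
  have hI : Icc t₁ t₂ ⊆ Ici 0 := fun t h => ht₁.trans h.1
  have hlayer := fun t (h : 0 ≤ t) => integral_mul_integral_Ioi_signedInfDist
    (hum.integrableOn_apply (isOpen_parallelDomain (Ω := Ω) δ) hB h i) hg.continuous hgc hβ hgs
  obtain ⟨Kg, hKg⟩ := hgc.exists_bound_of_continuous hg.continuous
  have hgF : Integrable (fun z : EuclideanSpace ℝ (Fin n) × ℝ =>
      g (d z.1) * inner ℝ (f (u z.1 z.2) i) (∇ d z.1))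
      ((volume.restrict T).prod (volume.restrict (Icc t₁ t₂))) :=
    hF.bdd_mul (hg.continuous.measurable.comp
      (measurable_signedInfDist.comp measurable_fst)).aestronglyMeasurable
      (Eventually.of_forall fun z => hKg _)
  set M : ℝ → ℝ := fun t => ∫ y, g y * ∫ x in parallelDomain Ω y, u x t i with hM
  set Q : ℝ → ℝ := fun t => ∫ x in T, g (d x) * inner ℝ (f (u x t) i) (∇ d x) with hQ
  have hQi : IntervalIntegrable Q volume t₁ t₂ := by
    rw [intervalIntegrable_iff_integrableOn_Icc_of_le ht.le]
    exact hgF.integral_prod_right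
  -- Dominated convergence in y: each mass is continuous in t, and all are bounded in terms of the
  -- volume of Ω_δ.
  have hMc : ContinuousOn M (Icc t₁ t₂) := by
    have hgint : Integrable g := hg.continuous.integrable_of_hasCompactSupport hgc
    refine continuousOn_of_dominated
      (bound := fun y => |g y| * (K * volume.real (parallelDomain Ω δ)))
      (fun t h => (hlayer t (hI h)).1.aestronglyMeasurable) (fun t h => ?_)
      (hgint.abs.mul_const _) ?_
    · refine Eventually.of_forall fun y => ?_
      rw [norm_mul, Real.norm_eq_abs, Real.norm_eq_abs]
      by_cases hy : y ≤ δ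
      · have hsub := parallelDomain_mono (Ω := Ω) hy
        have hb := abs_mass_le hsub (hB.subset hsub).measure_lt_top.ne ht hK i
          ((hum.continuousOn_apply (isOpen_parallelDomain y) (hB.subset hsub) i).mono hI) t h
        have hb' := abs_mass_le Subset.rfl hB.measure_lt_top.ne ht hK i
          ((hum.continuousOn_apply (isOpen_parallelDomain δ) hB i).mono hI) t h
        refine mul_le_mul_of_nonneg_left (hb.trans ?_) (abs_nonneg _)
        -- K carries no sign here; if it is negative, the mass bound on Ω_δ forces that domain to be
        -- null.
        by_cases hKn : 0 ≤ K
        · exact mul_le_mul_of_nonneg_left (measureReal_mono hsub hB.measure_lt_top.ne) hKn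
        · have h0 : volume.real (parallelDomain Ω δ) ≤ 0 := by
            by_contra! hpos
            nlinarith [abs_nonneg (∫ x in parallelDomain Ω δ, u x t i)]
          have h0' := measureReal_mono (μ := volume) hsub hB.measure_lt_top.ne
          have h1 := measureReal_nonneg (μ := volume) (s := parallelDomain Ω y)
          have h2 : volume.real (parallelDomain Ω δ) = 0 := le_antisymm h0 (h1.trans h0')
          have h3 : volume.real (parallelDomain Ω y) = 0 := le_antisymm (h0'.trans h0) h1
          rw [h2, h3]
      · have : g y = 0 := image_eq_zero_of_notMem_tsupport fun h => hy ((hgs h).2.trans hβ.le)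
        simp [this]
    · refine Eventually.of_forall fun y => ?_
      by_cases hy : y ≤ δ
      · exact continuousOn_const.mul ((hum.continuousOn_apply (isOpen_parallelDomain y)
          (hB.subset (parallelDomain_mono hy)) i).mono hI)
      · have : g y = 0 := image_eq_zero_of_notMem_tsupport fun h => hy ((hgs h).2.trans hβ.le)
        simp only [this, zero_mul]
        exact continuousOn_const
  have key := sub_eq_neg_integral_of_weak_deriv ht hMc hQi fun χ hχ hχc hχs => ?_
  · rw [intervalIntegral.integral_of_le ht.le, ← integral_Icc_eq_integral_Ioc] at key
    exact key
  · have hweak := hu.integral_test_eq_zero (isOpen_parallelDomain (Ω := Ω) δ) hB ht₁ ht i hwd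
      (A := {x | d x ≤ β}) (isClosed_le continuous_signedInfDist continuous_const)
      (fun x hx => lt_of_le_of_lt hx hβ) (fun x hx => by
        by_contra hn
        exact hx (integral_Ioi_eq_zero_of_le hgs (not_le.1 hn).le)) hχ hχc hχs
    rw [← hweak, intervalIntegral.integral_of_le ht.le, intervalIntegral.integral_of_le ht.le,
      ← integral_Icc_eq_integral_Ioc, ← integral_Icc_eq_integral_Ioc]
    refine integral_congr_ae ?_
    filter_upwards [hgF.prod_left_ae, ae_restrict_mem measurableSet_Icc] with t hti htI
    -- Deep inside Ω the cutoff is constant, so the flux integral over Ω_δ only sees the tube.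
    have hz : ∀ x ∈ parallelDomain Ω δ \ T, g (d x) * inner ℝ (f (u x t) i) (∇ d x) = 0 := by
      rintro x ⟨-, hx⟩
      have : g (d x) = 0 := image_eq_zero_of_notMem_tsupport fun h => hx
        (show |d x| < δ from abs_lt.2 ⟨hα.trans_le (hgs h).1, (hgs h).2.trans_lt hβ⟩)
      rw [this, zero_mul]
    have hti' : IntegrableOn (fun x => g (d x) * inner ℝ (f (u x t) i) (∇ d x))
        (parallelDomain Ω δ) :=
      IntegrableOn.of_forall_sdiff_eq_zero hti (isOpen_parallelDomain δ).measurableSet hz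
    have hQt : Q t = ∫ x in parallelDomain Ω δ, g (d x) * inner ℝ (f (u x t) i) (∇ d x) :=
      (setIntegral_eq_of_subset_of_forall_sdiff_eq_zero (isOpen_parallelDomain δ).measurableSet
        hTB hz).symm
    have hpt : ∀ x, u x t i * (deriv χ t * w x) + χ t * inner ℝ (f (u x t) i) (∇ w x) =
        deriv χ t * (u x t i * w x) - χ t * (g (d x) * inner ℝ (f (u x t) i) (∇ d x)) := by
      intro x
      rw [hwg, inner_neg_right, inner_smul_right]
      ring
    refine Eq.trans ?_ (integral_congr_ae (Eventually.of_forall fun x => (hpt x).symm))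
    rw [integral_sub ((hlayer t (hI htI)).2.1.const_mul _) (hti'.const_mul _), integral_const_mul,
      integral_const_mul, ← hQt, (hlayer t (hI htI)).2.2]

end Balance

/-! ### Identification and uniqueness of the flux -/

section Flux

open ProbabilityTheory
open scoped ENNReal

variable {n D : ℕ} {Ω : Set (EuclideanSpace ℝ (Fin n))}
  {f : EuclideanSpace ℝ (Fin D) → Fin D → EuclideanSpace ℝ (Fin n)}
  {u : EuclideanSpace ℝ (Fin n) → ℝ → EuclideanSpace ℝ (Fin D)}

/-- Both Lipschitz functions equal the same surface fluxes almost everywhere near 0, and continuity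
carries the equality to 0. -/
theorem IsBoundaryFlux.unique {t₁ t₂ : ℝ} {h h' : Fin D → ℝ}
    (hh : IsBoundaryFlux f u Ω t₁ t₂ h) (hh' : IsBoundaryFlux f u Ω t₁ t₂ h') : h' = h := by
  obtain ⟨δ, hδ, H, ⟨K, hK⟩, hH, rfl⟩ := hh
  obtain ⟨δ', hδ', H', ⟨K', hK'⟩, hH', rfl⟩ := hh'
  have h0 : 0 < min δ δ' := lt_min hδ hδ'
  have hs : Ioo (-min δ δ') (min δ δ') ⊆ Ioo (-δ) δ :=
    Ioo_subset_Ioo (neg_le_neg (min_le_left _ _)) (min_le_left _ _)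
  have hs' : Ioo (-min δ δ') (min δ δ') ⊆ Ioo (-δ') δ' :=
    Ioo_subset_Ioo (neg_le_neg (min_le_right _ _)) (min_le_right _ _)
  have hae : H' =ᵐ[volume.restrict (Ioo (-min δ δ') (min δ δ'))] H := by
    filter_upwards [ae_restrict_of_ae_restrict_of_subset hs hH,
      ae_restrict_of_ae_restrict_of_subset hs' hH'] with y hy hy'
    funext i
    rw [(hy i).2, (hy' i).2]
  exact Measure.eqOn_open_of_ae_eq hae isOpen_Ioo (hK'.continuousOn.mono hs')
    (hK.continuousOn.mono hs) ⟨by linarith, h0⟩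

/-- Distance to the empty set is 0 by convention, so d vanishes identically and each Ω_y is empty or
the whole space; neither has a boundary. -/
theorem isBoundaryFlux_empty (t₁ t₂ : ℝ) : IsBoundaryFlux f u ∅ t₁ t₂ 0 := by
  have hsurf : ∀ y, surfaceMeasure (parallelDomain (∅ : Set (EuclideanSpace ℝ (Fin n))) y) = 0 := by
    intro y
    have hd : ∀ x, signedInfDist (∅ : Set (EuclideanSpace ℝ (Fin n))) x = 0 := fun x => by
      rw [signedInfDist, Metric.infDist_empty, compl_empty,
        Metric.infDist_zero_of_mem (mem_univ x), sub_zero]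
    have hp : parallelDomain (∅ : Set (EuclideanSpace ℝ (Fin n))) y = {_x | 0 < y} := by
      ext x; rw [parallelDomain, mem_ofPred_eq, hd]; rfl
    rw [surfaceMeasure, hp]
    by_cases hy : 0 < y <;> simp [hy]
  refine ⟨1, one_pos, fun _ => 0, ⟨0, (LipschitzWith.const 0).lipschitzOnWith⟩,
    Eventually.of_forall fun y i => ?_, rfl⟩
  rw [fluxIntegral, hsurf]
  simp

/-- The du Bois-Reymond step in y: the weak balance law and the disintegration give ∫ g (H - G) = 0
for every test function g on (-δ, δ), where G is the surface flux. -/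
theorem ae_neg_mass_sub_eq_flux {δ : ℝ} (hu : IsWeakSolution f u) (hum : HasContinuousMass u)
    (hB : Bornology.IsBounded (parallelDomain Ω δ)) {t₁ t₂ K : ℝ} (ht₁ : 0 ≤ t₁) (ht : t₁ < t₂)
    (hK : ∀ᵐ z ∂((volume.restrict (parallelDomain Ω δ)).prod (volume.restrict (Icc t₁ t₂))),
      ‖u z.1 z.2‖ ≤ K) (i : Fin D) (hδ : 0 < δ)
    (hd : ∀ x, |signedInfDist Ω x| < δ →
      ContDiffAt ℝ ∞ (signedInfDist Ω) x ∧ ‖∇ (signedInfDist Ω) x‖ = 1)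
    {κ : Kernel ℝ (EuclideanSpace ℝ (Fin n))} [IsFiniteKernel κ]
    (hκs : ∀ y, |y| < δ → κ y = surfaceMeasure (parallelDomain Ω y))
    (hκ : ∀ y, ∀ᵐ x ∂κ y, signedInfDist Ω x = y)
    (hvol : κ ∘ₘ volume = volume.restrict {x | |signedInfDist Ω x| < δ})
    (hF : Integrable (fun z : EuclideanSpace ℝ (Fin n) × ℝ =>
        inner ℝ (f (u z.1 z.2) i) (∇ (signedInfDist Ω) z.1))
      ((volume.restrict {x | |signedInfDist Ω x| < δ}).prod (volume.restrict (Icc t₁ t₂))))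
    (hFy : ∀ᵐ y, Integrable (fun z : EuclideanSpace ℝ (Fin n) × ℝ =>
        inner ℝ (f (u z.1 z.2) i) (∇ (signedInfDist Ω) z.1))
      ((κ y).prod (volume.restrict (Icc t₁ t₂))))
    (hH : ContinuousOn (fun y => -((∫ x in parallelDomain Ω y, u x t₂ i) -
      ∫ x in parallelDomain Ω y, u x t₁ i)) (Ioo (-δ) δ)) :
    ∀ᵐ y ∂(volume.restrict (Ioo (-δ) δ)),
      Integrable (fun z : EuclideanSpace ℝ (Fin n) × ℝ =>
          normalFluxDensity f u (parallelDomain Ω y) i z.1 z.2)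
        ((surfaceMeasure (parallelDomain Ω y)).prod (volume.restrict (Icc t₁ t₂))) ∧
      -((∫ x in parallelDomain Ω y, u x t₂ i) - ∫ x in parallelDomain Ω y, u x t₁ i) =
        fluxIntegral f u t₁ t₂ (parallelDomain Ω y) i := by
  set d := signedInfDist Ω with hd_def
  set F : EuclideanSpace ℝ (Fin n) × ℝ → ℝ := fun z => inner ℝ (f (u z.1 z.2) i) (∇ d z.1)
    with hFdef
  set τ : Measure ℝ := volume.restrict (Icc t₁ t₂) with hτ
  set G : ℝ → ℝ := fun y => ∫ t, ∫ x, F (x, t) ∂κ y ∂τ with hG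
  set H : ℝ → ℝ := fun y => -((∫ x in parallelDomain Ω y, u x t₂ i) -
      ∫ x in parallelDomain Ω y, u x t₁ i) with hHdef
  have hdm : Measurable d := measurable_signedInfDist
  have hF' : Integrable F ((κ ∘ₘ volume).prod τ) := by rw [hvol]; exact hF
  have hsf : SFinite (κ ∘ₘ (volume : Measure ℝ)) := by rw [hvol]; infer_instance
  -- Only the integrability part of the disintegration is wanted, so the weight is taken to be zero.
  have hGi : Integrable G :=
    (integral_comp_level_mul hdm hκ hF' hFy (g := fun _ => 0) measurable_const (K := 0)
      (by simp)).1
  have htest : ∀ g : ℝ → ℝ, ContDiff ℝ ∞ g → HasCompactSupport g → tsupport g ⊆ Ioo (-δ) δ →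
      ∫ y, g y • (H y - G y) = 0 := by
    intro g hg hgc hgs
    obtain ⟨α, β, hα, -, hβ, hgαβ⟩ := exists_tsupport_subset_Icc (by linarith) hgc hgs
    obtain ⟨Kg, hKg⟩ := hgc.exists_bound_of_continuous hg.continuous
    have h1 := integral_mul_mass_sub_eq hu hum hB ht₁ ht hK i hd hF hg hgc hα hβ hgαβ
    have h2 := (integral_comp_level_mul hdm hκ hF' hFy hg.continuous.measurable hKg).2
    rw [hvol] at h2
    have hl := fun t (h : 0 ≤ t) => (integral_mul_integral_Ioi_signedInfDist
      (hum.integrableOn_apply (isOpen_parallelDomain (Ω := Ω) δ) hB h i)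
      hg.continuous hgc hβ hgαβ).1
    have hi2 := hl t₂ (ht₁.trans ht.le)
    have hi1 := hl t₁ ht₁
    have hi12 : Integrable (fun y => g y * (∫ x in parallelDomain Ω y, u x t₁ i) -
        g y * ∫ x in parallelDomain Ω y, u x t₂ i) := hi1.sub hi2
    have hgH : ∀ y, g y • (H y - G y) = g y * (∫ x in parallelDomain Ω y, u x t₁ i) -
        g y * (∫ x in parallelDomain Ω y, u x t₂ i) - g y * G y := by
      intro y; rw [smul_eq_mul, hHdef]; ring
    simp_rw [hgH]
    rw [integral_sub hi12 (hGi.bdd_mul hg.continuous.aestronglyMeasurable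
      (Eventually.of_forall hKg)), integral_sub hi1 hi2]
    linarith [h1.trans (congrArg Neg.neg h2)]
  have hloc : LocallyIntegrableOn (fun y => H y - G y) (Ioo (-δ) δ) :=
    (hH.locallyIntegrableOn measurableSet_Ioo).sub (hGi.locallyIntegrable.locallyIntegrableOn _)
  have hae := isOpen_Ioo.ae_eq_zero_of_integral_contDiff_smul_eq_zero hloc htest
  rw [ae_restrict_iff' measurableSet_Ioo]
  filter_upwards [hae, hFy] with y hy hyF hyI
  have hyδ : |y| < δ := abs_lt.2 hyI
  have hν : ∀ᵐ x ∂κ y, ∀ t, normalFluxDensity f u (parallelDomain Ω y) i x t = F (x, t) := by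
    filter_upwards [hκ y] with x hx t
    have hx' : |d x| < δ := by rwa [hx]
    have := outwardUnitNormal_parallelDomain hd hx'
    rw [← hd_def, hx] at this
    rw [normalFluxDensity, this]
  rw [← hκs y hyδ]
  constructor
  · refine hyF.congr ?_
    filter_upwards [Measure.quasiMeasurePreserving_fst.ae hν] with z hz
    exact (hz z.2).symm
  · change H y = _
    rw [sub_eq_zero.1 (hy hyI), fluxIntegral, ← hκs y hyδ, intervalIntegral.integral_of_le ht.le,
      ← integral_Icc_eq_integral_Ioc]
    refine integral_congr_ae (Eventually.of_forall fun t => integral_congr_ae ?_)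
    filter_upwards [hν] with x hx
    exact (hx t).symm

end Flux

/-! ### The fundamental theorem of fluxes -/

theorem mainTheorem1 {n D : ℕ} (hn : 1 ≤ n)
    (f : EuclideanSpace ℝ (Fin D) → Fin D → EuclideanSpace ℝ (Fin n)) (hf : Continuous f)
    (u₀ : EuclideanSpace ℝ (Fin n) → EuclideanSpace ℝ (Fin D))
    (hu₀_one : MemLp u₀ 1 volume) (hu₀_top : MemLp u₀ ⊤ volume)
    (u : EuclideanSpace ℝ (Fin n) → ℝ → EuclideanSpace ℝ (Fin D))
    (hu_meas : AEStronglyMeasurable (fun z : EuclideanSpace ℝ (Fin n) × ℝ => u z.1 z.2)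
      (volume.restrict (univ ×ˢ Ici 0)))
    (hu_weak : IsWeakSolution f u)
    (hu_init : ∀ᵐ x, u x 0 = u₀ x)
    (hu_bdd : IsLocallyBounded u)
    (hu_mass : HasContinuousMass u)
    (Ω : Set (EuclideanSpace ℝ (Fin n))) (hΩ : IsSmoothBoundedDomain Ω)
    (t₁ t₂ : ℝ) (ht₁ : 0 ≤ t₁) (ht : t₁ < t₂) :
    ∃ h : Fin D → ℝ,
      IsBoundaryFlux f u Ω t₁ t₂ h ∧
      (∀ h' : Fin D → ℝ, IsBoundaryFlux f u Ω t₁ t₂ h' → h' = h) ∧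
      ∀ i : Fin D, (∫ x in Ω, u x t₂ i) - (∫ x in Ω, u x t₁ i) = - h i := by
  suffices hmain : ∃ h : Fin D → ℝ, IsBoundaryFlux f u Ω t₁ t₂ h ∧
      ∀ i : Fin D, (∫ x in Ω, u x t₂ i) - (∫ x in Ω, u x t₁ i) = - h i by
    obtain ⟨h, hh, hbal⟩ := hmain
    exact ⟨h, hh, fun h' hh' => hh.unique hh', hbal⟩
  rcases Ω.eq_empty_or_nonempty with rfl | hne
  · exact ⟨0, isBoundaryFlux_empty t₁ t₂, by simp⟩
  -- Here n ≥ 1 enters: in dimension zero the whole space is bounded.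
  have hne' : Ω ≠ univ := by
    rintro rfl
    have : Nonempty (Fin n) := ⟨⟨0, hn⟩⟩
    exact NormedSpace.unbounded_univ ℝ (EuclideanSpace ℝ (Fin n)) hΩ.isBounded
  obtain ⟨δ, hδ, hd, C, hC⟩ := hΩ.exists_tube hne hne'
  obtain ⟨κ, hκfin, hκC, hκs, hκ, hvol⟩ := exists_surface_kernel hd hC
  have hB := isBounded_parallelDomain hΩ.isBounded hne δ
  set B := parallelDomain Ω δ with hBdef
  set T := {x | |signedInfDist Ω x| < δ} with hT
  have hTB : T ⊆ B := fun x hx => (abs_lt.1 (show |signedInfDist Ω x| < δ from hx)).2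
  -- essential bound and measurability of `u` near the boundary
  have hcpt : IsCompact (closure B ×ˢ Icc t₁ t₂) := hB.isCompact_closure.prod isCompact_Icc
  have hsub0 : closure B ×ˢ Icc t₁ t₂ ⊆ univ ×ˢ Ici 0 :=
    prod_mono (subset_univ _) fun t h => ht₁.trans h.1
  obtain ⟨K₀, hK₀⟩ := hu_bdd _ hcpt hsub0
  have hprod : ∀ S : Set (EuclideanSpace ℝ (Fin n)),
      (volume.restrict S).prod (volume.restrict (Icc t₁ t₂)) =
        (volume : Measure (EuclideanSpace ℝ (Fin n) × ℝ)).restrict (S ×ˢ Icc t₁ t₂) :=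
    fun S => Measure.prod_restrict S (Icc t₁ t₂)
  set K := max K₀ 0 with hKdef
  have hK : ∀ᵐ z ∂((volume.restrict B).prod (volume.restrict (Icc t₁ t₂))), ‖u z.1 z.2‖ ≤ K := by
    rw [hprod]
    filter_upwards [ae_restrict_of_ae_restrict_of_subset
      (prod_mono subset_closure Subset.rfl) hK₀] with z hz
    exact hz.trans (le_max_left _ _)
  have hK0 : 0 ≤ K := le_max_right _ _
  have hTu : AEStronglyMeasurable (fun z : EuclideanSpace ℝ (Fin n) × ℝ => u z.1 z.2)
      ((volume.restrict T).prod (volume.restrict (Icc t₁ t₂))) := by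
    rw [hprod]
    exact hu_meas.mono_set ((prod_mono (hTB.trans subset_closure) Subset.rfl).trans hsub0)
  have hTK : ∀ᵐ z ∂((volume.restrict T).prod (volume.restrict (Icc t₁ t₂))),
      ‖u z.1 z.2‖ ≤ K := by
    rw [hprod] at hK ⊢
    exact ae_restrict_of_ae_restrict_of_subset (prod_mono hTB Subset.rfl) hK
  have hfi : ∀ i, Continuous fun v => f v i := fun i => (continuous_apply i).comp hf
  -- Essentially all values of u near ∂Ω lie in a compact ball, on which the continuous f is
  -- bounded.
  have hflux : ∀ i, _ := fun i =>
    let ⟨K₁, hK₁⟩ :=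
      (isCompact_closedBall (0 : EuclideanSpace ℝ (Fin D)) K).exists_bound_of_continuousOn
        (hfi i).continuousOn
    integrable_normal_component hd hvol (hB.subset hTB).measure_lt_top.ne
      ((hfi i).comp_aestronglyMeasurable hTu) (K := K₁) (by
        filter_upwards [hTK] with z hz
        exact hK₁ _ (mem_closedBall_zero_iff.2 hz))
  -- the candidate flux
  set H : ℝ → Fin D → ℝ := fun y i => -((∫ x in parallelDomain Ω y, u x t₂ i) -
    ∫ x in parallelDomain Ω y, u x t₁ i) with hH
  have hshell : ∀ i : Fin D, ∀ t ∈ Icc t₁ t₂, ∀ y ∈ Ioo (-δ) δ, ∀ y' ∈ Ioo (-δ) δ, y' ≤ y →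
      |(∫ x in parallelDomain Ω y, u x t i) - ∫ x in parallelDomain Ω y', u x t i| ≤
        K * C * (y - y') := by
    intro i t h y hy y' hy' hyy'
    refine (abs_mass_sub_le hu_mass hB ht₁ ht hK i hyy' hy.2.le t h).trans ?_
    rw [mul_assoc]
    refine mul_le_mul_of_nonneg_left ?_ hK0
    have := volume_parallelDomain_diff_le hκC hκ hvol hy'.1 hy.2
    refine ENNReal.toReal_le_of_le_ofReal (mul_nonneg C.2 (sub_nonneg.2 hyy')) (this.trans_eq ?_)
    rw [ENNReal.ofReal_mul (p := (C : ℝ)) C.2, ENNReal.ofReal_coe_nnreal]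
  -- The factor 2 accounts for the two times t₁ and t₂.
  have hLip : LipschitzOnWith (2 * (K.toNNReal * C)) H (Ioo (-δ) δ) := by
    have hone : ∀ y ∈ Ioo (-δ) δ, ∀ y' ∈ Ioo (-δ) δ, y' ≤ y →
        dist (H y) (H y') ≤ (2 * (K.toNNReal * C) : ℝ≥0) * dist y y' := by
      intro y hy y' hy' hyy'
      refine (dist_pi_le_iff (by positivity)).2 fun i => ?_
      have h1 := hshell i t₁ (left_mem_Icc.2 ht.le) y hy y' hy' hyy'
      have h2 := hshell i t₂ (right_mem_Icc.2 ht.le) y hy y' hy' hyy'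
      push_cast
      rw [Real.coe_toNNReal _ hK0, Real.dist_eq, Real.dist_eq, abs_of_nonneg (sub_nonneg.2 hyy')]
      rw [abs_le] at h1 h2 ⊢
      constructor <;> simp only [hH] <;> linarith [h1.1, h1.2, h2.1, h2.2]
    refine LipschitzOnWith.of_dist_le_mul fun y hy y' hy' => ?_
    rcases le_total y' y with h | h
    · exact hone y hy y' hy' h
    · rw [dist_comm, dist_comm y]
      exact hone y' hy' y hy h
  refine ⟨H 0, ⟨δ, hδ, H, ⟨_, hLip⟩, ?_, rfl⟩, fun i => ?_⟩
  · rw [ae_all_iff]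
    intro i
    exact ae_neg_mass_sub_eq_flux hu_weak hu_mass hB ht₁ ht hK i hδ hd hκs hκ hvol
      (hflux i).1 (hflux i).2 ((continuous_apply i).comp_continuousOn hLip.continuousOn)
  · rw [hH]
    simp only [parallelDomain_zero hΩ.isOpen hne', neg_neg]
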